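/- **Setting.** Fix integers $p\ge 1$, $d\ge 0$ and a Bayesian model: a measurable parameter space $\Theta\subseteq\mathbb R^p$; for every $n$ and every dataset $Y=(Y_1,\dots,Y_n)\in\mathbb R^{n\times d}$ a measurable likelihood $\theta\mapsto\pi(Y\mid\theta)\ge 0$ on $\Theta$; and a prior density $\pi(\theta)\ge 0$ with $\int_\Theta\pi(\theta)\,d\theta=1$. For every $n$ the data $Y$ are drawn from a probability distribution $P_n^*$ (the model need not be i.i.d. or well specified). Put $\ell_n(\theta)=\log\pi(Y\mid\theta)$ (with $\log 0=-\infty$), $\pi(\theta,Y)=\pi(\theta)\,\pi(Y\mid\theta)$, $\ell_n^\pi(\theta)=\log\pi(\theta,Y)$, $\pi(Y)=\int_\Theta\pi(\theta,Y)\,d\theta$, and $H_n(\theta)=-\partial^2_\theta\ell_n^\pi(\theta)$. Let $\hat\theta_n=\hat\theta_n(Y)$ be a posterior mode, i.e. with $P_n^*$-probability tending to $1$, $\hat\theta_n\in\Theta$ and $\hat\theta_n$ maximizes $\pi(\theta,Y)$ over $\theta\in\Theta$. A quadrature rule $(\mathcal Q,\omega)$ is a finite set $\mathcal Q\subset\mathbb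 R^p$ with weights $\omega:\mathcal Q\to\mathbb R$. It is symmetric if $z\in\mathcal Q$ implies $-z\in\mathcal Q$ and $\omega(-z)=\omega(z)$. It satisfies $\mathcal P(k,p)$ if, with $\phi$ the standard normal density on $\mathbb R^p$, for every real polynomial $f$ in $p$ variables of total degree at most $2k-1$, $$\int_{\mathbb R^p}\phi(z)f(z)\,dz=\sum_{z\in\mathcal Q}\phi(z)f(z)\,\omega(z).$$ Its adaptive approximation of $\pi(Y)$ is $$\tilde\pi(Y)=\det(\hat L_n)\sum_{z\in\mathcal Q}\pi(\hat L_n z+\hat\theta_n,\,Y)\,\omega(z),$$ where $\hat L_n$ is the lower triangular Cholesky factor with positive diagonal, $\hat L_n\hat L_n^{\top}=[H_n(\hat\theta_n)]^{-1}$. **Theorem.** Let $D\ge 4$ and suppose that, for all $n$ and $Y$, $\theta\mapsto\pi(Y\mid\theta)$ is $D$ times differentiable (in the interior of $\Theta$), and that there are $\delta>0$ and $\theta^*\in\Theta$ such that the open Euclidean ball $B=B(\theta^*,\delta)$ is contained in $\Theta$ and the following hold. 1. There is $M>0$ such that, with $P_n^*$-probability tending to $1$, $\ell_n^\pi$ is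 finite and $D$ times differentiable on $B$, and for every multi-index $\alpha$ with $0\le|\alpha|\le D$, with $P_n^*$-probability tending to $1$, $\sup_{\theta\in B}|\partial^\alpha\ell_n^\pi(\theta)|\le nM$. 2. There are $0<\underline\eta\le\overline\eta<\infty$ such that, with $P_n^*$-probability tending to $1$, all eigenvalues of $H_n(\theta)$ lie in $[n\underline\eta,n\overline\eta]$ for all $\theta\in B$. 3. There is $b>0$ such that, with $P_n^*$-probability tending to $1$, $\ell_n(\theta)-\ell_n(\theta^*)\le -nb$ for all $\theta\in\Theta\setminus B$. 4. For every $\beta>0$ and every $G:\mathbb N\to\mathbb R$ with $G(n)\to\infty$, $P_n^*\big[\tfrac{\sqrt n}{G(n)}\|\hat\theta_n-\theta^*\|_2>\beta\big]\to 0$. 5. There are $0<c_1<c_2<\infty$ with $c_1\le\pi(\theta)\le c_2$ for all $\theta\in B$. Let $1\le k\le\lfloor D/2\rfloor$ and let $(\mathcal Q,\omega)$ be a symmetric quadrature rule satisfying $\mathcal P(k,p)$. Then there is a constant $C>0$ such that $$\lim_{n\to\infty}P_n^*\left(\left|\frac{\pi(Y)}{\tilde\pi(Y)}-1\right|\le C\,n^{-\lfloor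 (k+2)/3\rfloor}\right)=1.$$ -/

import Mathlib

open MeasureTheory Filter Topology

noncomputable section

namespace AdaptiveQuadrature

/-- The parameter-dimension Euclidean space `ℝ^p`. -/
abbrev Vec (p : ℕ) : Type := EuclideanSpace ℝ (Fin p)

/-- Datasets `Y = (Y₁, …, Yₙ)` of `n` observations in `ℝ^d`. -/
abbrev Dataset (n d : ℕ) : Type := Fin n → EuclideanSpace ℝ (Fin d)

/-- The `i`-th standard basis vector. -/
def e {p : ℕ} (i : Fin p) : Vec p := EuclideanSpace.single i 1

/-- A Bayesian model: a parameter space, for every sample size a likelihood, and a (proper) prior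
density. No independence, identical distribution or well-specification is required. Only the values
of `lik` and `prior` on `Θ` carry meaning. -/
structure Model (p d : ℕ) where
  Θ : Set (Vec p)
  measurableSet_Θ : MeasurableSet Θ
  lik : ∀ n : ℕ, Dataset n d → Vec p → ℝ
  lik_nonneg : ∀ n y, ∀ θ ∈ Θ, 0 ≤ lik n y θ
  aemeasurable_lik : ∀ n y, AEMeasurable (lik n y) (volume.restrict Θ)
  prior : Vec p → ℝ
  prior_nonneg : ∀ θ ∈ Θ, 0 ≤ prior θ
  integrable_prior : IntegrableOn prior Θ
  integral_prior : ∫ θ in Θ, prior θ = 1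

/-- `f` is `D` times (Fréchet) differentiable on the open set `U`. The derivative of order `D`
is not required to be continuous. -/
def DiffTimesOn {p : ℕ} (D : ℕ) (f : Vec p → ℝ) (U : Set (Vec p)) : Prop :=
  ∀ m < D, DifferentiableOn ℝ (iteratedFDeriv ℝ m f) U

/-- The partial derivative `∂_{i₁} ⋯ ∂_{iₘ} f (x)`. -/
def partialDeriv {p m : ℕ} (i : Fin m → Fin p) (f : Vec p → ℝ) (x : Vec p) : ℝ :=
  iteratedFDeriv ℝ m f x (fun j => e (i j))

/-- "`A n` holds with `P n`-probability tending to one". It is phrased through the (outer) measure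
of the complement, so that it is meaningful without measurability of the events; for measurable
events and probability measures it says that `P n (A n) → 1`. -/
def WithProbTendingToOne {d : ℕ} (P : ∀ n : ℕ, Measure (Dataset n d))
    (A : ∀ n : ℕ, Dataset n d → Prop) : Prop :=
  Tendsto (fun n => P n {y | ¬ A n y}) atTop (𝓝 0)

namespace Model

variable {p d : ℕ} (𝓜 : Model p d)

/-- The unnormalized posterior density `π(θ) π(Y ∣ θ)`. -/
def post (n : ℕ) (y : Dataset n d) (θ : Vec p) : ℝ := 𝓜.prior θ * 𝓜.lik n y θ

/-- The log-likelihood, with `log 0 = -∞`. -/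
def logLik (n : ℕ) (y : Dataset n d) (θ : Vec p) : EReal :=
  ENNReal.log (ENNReal.ofReal (𝓜.lik n y θ))

/-- The unnormalized log-posterior. It is only used where the posterior density is positive. -/
def logPost (n : ℕ) (y : Dataset n d) (θ : Vec p) : ℝ := Real.log (𝓜.post n y θ)

/-- The marginal likelihood `π(Y)`. -/
def marginal (n : ℕ) (y : Dataset n d) : ℝ := ∫ θ in 𝓜.Θ, 𝓜.post n y θ

/-- `m` is a posterior mode: a maximizer over `Θ` of the posterior density. -/
def IsPosteriorMode (n : ℕ) (y : Dataset n d) (m : Vec p) : Prop :=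
  m ∈ 𝓜.Θ ∧ ∀ θ ∈ 𝓜.Θ, 𝓜.post n y θ ≤ 𝓜.post n y m

/-- The negative Hessian `Hₙ(θ)` of the log-posterior. -/
def negHessian (n : ℕ) (y : Dataset n d) (θ : Vec p) : Matrix (Fin p) (Fin p) ℝ :=
  Matrix.of fun i j => - partialDeriv ![i, j] (𝓜.logPost n y) θ

end Model

/-- `L` is the Cholesky factor of `A`: `A = L Lᵀ` with `L` lower triangular with positive
diagonal. -/
def IsCholesky {p : ℕ} (A L : Matrix (Fin p) (Fin p) ℝ) : Prop :=
  (∀ i j, i < j → L i j = 0) ∧ (∀ i, 0 < L i i) ∧ L * L.transpose = A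

open Classical in
/-- The Cholesky factor of `A` (it exists and is unique for symmetric positive definite `A`;
it is set to `0` if there is none). -/
def cholesky {p : ℕ} (A : Matrix (Fin p) (Fin p) ℝ) : Matrix (Fin p) (Fin p) ℝ :=
  if h : ∃ L, IsCholesky A L then h.choose else 0

/-- The standard normal density on `ℝ^p`. -/
def stdNormal {p : ℕ} (z : Vec p) : ℝ :=
  (2 * Real.pi) ^ (-(p : ℝ) / 2) * Real.exp (-‖z‖ ^ 2 / 2)

/-- A quadrature rule: finitely many points with real (possibly negative) weights. -/
structure QuadRule (p : ℕ) where
  points : Finset (Vec p)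
  weight : Vec p → ℝ

namespace QuadRule

variable {p : ℕ} (R : QuadRule p)

/-- The rule is symmetric about the origin. -/
def IsSymmetric : Prop :=
  ∀ z ∈ R.points, -z ∈ R.points ∧ R.weight z = R.weight (-z)

/-- The rule is exact for the standard normal density times any polynomial of total order
at most `2k - 1`. -/
def IsExact (k : ℕ) : Prop :=
  ∀ f : MvPolynomial (Fin p) ℝ, f.totalDegree ≤ 2 * k - 1 →
    ∫ z : Vec p, stdNormal z * MvPolynomial.eval (fun i => z i) f =
      ∑ z ∈ R.points, stdNormal z * MvPolynomial.eval (fun i => z i) f * R.weight z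

/-- The adaptive quadrature approximation of the marginal likelihood, adapted to the location `m`
and to the curvature of the log-posterior there:
`det L * ∑ z, π(L z + m) π(Y ∣ L z + m) ω(z)`, where `L` is the Cholesky factor of `Hₙ(m)⁻¹`. -/
def adaptive {d : ℕ} (𝓜 : Model p d) (n : ℕ) (y : Dataset n d) (m : Vec p) : ℝ :=
  let L := cholesky (𝓜.negHessian n y m)⁻¹
  L.det * ∑ z ∈ R.points, 𝓜.post n y (WithLp.toLp 2 (L.mulVec z) + m) * R.weight z

end QuadRule

namespace Model

variable {p d : ℕ} (𝓜 : Model p d) (P : ∀ n : ℕ, Measure (Dataset n d))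

/-- On the ball of radius `δ` about `θs`, with probability tending to one the log-posterior is
finite and `D` times differentiable, and its partial derivatives of orders `0, …, D` are
bounded by `n M`. -/
def DerivBounds (D : ℕ) (δ : ℝ) (θs : Vec p) : Prop :=
  ∃ M > (0 : ℝ),
    WithProbTendingToOne P (fun n y =>
      (∀ θ ∈ Metric.ball θs δ, 0 < 𝓜.post n y θ) ∧
        DiffTimesOn D (𝓜.logPost n y) (Metric.ball θs δ)) ∧
    ∀ m ≤ D, ∀ i : Fin m → Fin p, WithProbTendingToOne P fun n y =>
      ∀ θ ∈ Metric.ball θs δ, |partialDeriv i (𝓜.logPost n y) θ| ≤ n * M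

/-- All eigenvalues of `Hₙ(θ)`, for `θ` in the ball, lie in `[n η₁, n η₂]`. -/
def HessianBounds (δ : ℝ) (θs : Vec p) : Prop :=
  ∃ η₁ η₂ : ℝ, 0 < η₁ ∧ η₁ ≤ η₂ ∧ WithProbTendingToOne P fun n y =>
    ∀ θ ∈ Metric.ball θs δ, ∀ μ ∈ spectrum ℝ (𝓜.negHessian n y θ),
      n * η₁ ≤ μ ∧ μ ≤ n * η₂

/-- Outside the ball, the log-likelihood is smaller by at least `n b` than at `θs`. -/
def Separation (δ : ℝ) (θs : Vec p) : Prop :=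
  ∃ b > (0 : ℝ), WithProbTendingToOne P fun n y =>
    ∀ θ ∈ 𝓜.Θ \ Metric.ball θs δ,
      𝓜.logLik n y θ - 𝓜.logLik n y θs ≤ ((-(n * b) : ℝ) : EReal)

/-- The prior density is bounded, and bounded away from zero, on the ball. -/
def PriorBounds (δ : ℝ) (θs : Vec p) : Prop :=
  ∃ c₁ c₂ : ℝ, 0 < c₁ ∧ c₁ < c₂ ∧
    ∀ θ ∈ Metric.ball θs δ, c₁ ≤ 𝓜.prior θ ∧ 𝓜.prior θ ≤ c₂

end Model

/-- `√n`-consistency of the estimator `mode` for `θs`. -/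
def RootNConsistent {p d : ℕ} (P : ∀ n : ℕ, Measure (Dataset n d))
    (mode : ∀ n : ℕ, Dataset n d → Vec p) (θs : Vec p) : Prop :=
  ∀ β > (0 : ℝ), ∀ G : ℕ → ℝ, Tendsto G atTop atTop →
    Tendsto (fun n : ℕ => P n {y | β < Real.sqrt n / G n * ‖mode n y - θs‖}) atTop (𝓝 0)

/-- The regularity assumptions, for one common radius and one common centre. As the log-posterior
and the prior density are evaluated on the ball, the ball lies in the parameter space. -/
def Model.Regular {p d : ℕ} (𝓜 : Model p d) (P : ∀ n : ℕ, Measure (Dataset n d))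
    (mode : ∀ n : ℕ, Dataset n d → Vec p) (D : ℕ) : Prop :=
  ∃ δ > (0 : ℝ), ∃ θs : Vec p, Metric.ball θs δ ⊆ 𝓜.Θ ∧
    𝓜.DerivBounds P D δ θs ∧
    𝓜.HessianBounds P δ θs ∧
    𝓜.Separation P δ θs ∧
    RootNConsistent P mode θs ∧
    𝓜.PriorBounds δ θs

end AdaptiveQuadrature

end

noncomputable section

namespace AdaptiveQuadrature

open scoped Nat
open Finset (range)

/-! ### The Taylor formula on the unit interval -/

/-! Write `m` for the mode, `f` for the log-posterior, `ε = n ^ (-1/2)`, and substitute `θ = L z +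
m`. The factor `L` normalizes the Hessian at `m` and the gradient vanishes there, so on the ball the
posterior density equals `post m * exp (-‖z‖²/2 + q z)`, with `q` the Taylor remainder of order
three. The factors `post m` and `det L` are common to the integral over the ball and to the rule, so
the two can be compared in the coordinate `z`.

Since `‖L z‖` is of order `ε ‖z‖` and the derivatives of `f` are of order `n = ε ^ (-2)`, the Taylor
term of order `j + 3` is `ε ^ (j + 1)` times a bounded polynomial, homogeneous of degree `j + 3`.
This degree is at most `3 (j + 1)` and has the parity of `j + 1`. Both properties are additive under
products, so after expanding the exponential the coefficient of `ε ^ s` is a polynomial of degree at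
most `3 s` and of the parity of `s` (`IsGraded`).

For odd `s` the integral and the symmetric rule both vanish. For even `s ≤ 2 r - 2` the degree is at
most `6 r - 6 ≤ 2 k - 2` as soon as `3 r ≤ k + 2`, so the rule is exact. Hence the first error has
order `ε ^ (2 r) = n ^ (-r)`, and `r = ⌊(k + 2) / 3⌋` is the largest admissible choice
(`QuadRule.error_eq_zero_of_isGraded`, `QuadRule.abs_error_partialSum_le`).

To integrate the truncation error, it needs Gaussian decay. The Hessian bound on the whole ball
gives `-‖z‖²/2 + q z ≤ -c ‖z‖²`, which controls the remainder of the exponential series even where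
`q` is large (`abs_exp_sub_partialSum_le`). Outside the ball the Gaussian tail is smaller than any
power of `ε`. As weights may be negative, the quadrature sum is bounded below through its closeness
to the integral (`QuadRule.exists_abs_integral_sub_sum_le`).

The posterior mass off the ball is at most `exp (-n b) / c₁` times `post m`; this beats the
polynomial growth of `(det L)⁻¹` (`Model.integral_post_diff_ball`). All of this is deterministic on
the intersection of finitely many events of probability tending to one. -/

lemma hasDerivAt_pow_div_factorial (a : ℝ) (i : ℕ) (t : ℝ) :
    HasDerivAt (fun t : ℝ => a * t ^ (i + 1) / ((i + 1)! : ℝ)) (a * t ^ i / (i ! : ℝ)) t := by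
  have h := ((hasDerivAt_pow (i + 1) t).const_mul a).div_const ((i + 1)! : ℝ)
  refine h.congr_deriv ?_
  have : (i ! : ℝ) ≠ 0 := by positivity
  rw [Nat.factorial_succ]
  push_cast
  field_simp

/-- The Taylor formula with a one-sided bound of the last derivative. -/
lemma le_taylor_of_le (J : ℕ) (g : ℕ → ℝ → ℝ) (K : ℝ)
    (hg : ∀ m < J, ∀ t ∈ Set.Icc (0 : ℝ) 1, HasDerivAt (g m) (g (m + 1) t) t)
    (hK : ∀ t ∈ Set.Icc (0 : ℝ) 1, g J t ≤ K) :
    ∀ t ∈ Set.Icc (0 : ℝ) 1,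
      g 0 t ≤ ∑ i ∈ range J, g i 0 * t ^ i / (i ! : ℝ) + K * t ^ J / (J ! : ℝ) := by
  induction J generalizing g with
  | zero => intro t ht; simpa using hK t ht
  | succ J ih =>
    intro t ht
    have h1 := ih (fun m => g (m + 1)) (fun m hm => hg (m + 1) (by omega)) hK
    -- `ψ` is the claimed bound minus `g 0`; its derivative is the slack of the induction hypothesis
    -- for `g 1`. Monotonicity replaces the integral remainder, so the last derivative need not be
    -- continuous.
    set ψ : ℝ → ℝ := fun t => ∑ i ∈ range J, g (i + 1) 0 * t ^ (i + 1) / ((i + 1)! : ℝ) +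
      K * t ^ (J + 1) / ((J + 1)! : ℝ) - g 0 t with hψ
    have hd : ∀ t ∈ Set.Icc (0 : ℝ) 1, HasDerivAt ψ
        (∑ i ∈ range J, g (i + 1) 0 * t ^ i / (i ! : ℝ) + K * t ^ J / (J ! : ℝ) - g 1 t) t := by
      intro t ht
      refine HasDerivAt.sub (HasDerivAt.add ?_ (hasDerivAt_pow_div_factorial K J t))
        (hg 0 (by omega) t ht)
      exact HasDerivAt.fun_sum fun i _ => hasDerivAt_pow_div_factorial (g (i + 1) 0) i t
    have hmono : MonotoneOn ψ (Set.Icc 0 1) := by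
      refine monotoneOn_of_deriv_nonneg (convex_Icc 0 1)
        (fun t ht => (hd t ht).continuousAt.continuousWithinAt)
        (fun t ht => (hd t (interior_subset ht)).differentiableAt.differentiableWithinAt)
        (fun t ht => ?_)
      rw [(hd t (interior_subset ht)).deriv]
      have := h1 t (interior_subset ht)
      simp only [zero_add] at this
      linarith
    have h0 := hmono (Set.left_mem_Icc.2 zero_le_one) ht ht.1
    simp only [hψ, ne_eq, Nat.add_eq_zero_iff, one_ne_zero, and_false, not_false_eq_true, zero_pow,
      mul_zero, zero_div, Finset.sum_const_zero, add_zero, zero_sub] at h0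
    rw [Finset.sum_range_succ']
    simp only [pow_zero, mul_one, Nat.factorial_zero, Nat.cast_one, div_one]
    linarith

/-- The Taylor formula with a two-sided bound of the last derivative. -/
lemma abs_sub_taylor_le (J : ℕ) (g : ℕ → ℝ → ℝ) (K : ℝ)
    (hg : ∀ m < J, ∀ t ∈ Set.Icc (0 : ℝ) 1, HasDerivAt (g m) (g (m + 1) t) t)
    (hK : ∀ t ∈ Set.Icc (0 : ℝ) 1, |g J t| ≤ K) :
    |g 0 1 - ∑ i ∈ range J, g i 0 / (i ! : ℝ)| ≤ K := by
  have hone : (1 : ℝ) ∈ Set.Icc (0 : ℝ) 1 := Set.right_mem_Icc.2 zero_le_one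
  have h1 := le_taylor_of_le J g K hg (fun t ht => (abs_le.1 (hK t ht)).2) 1 hone
  have h2 := le_taylor_of_le J (fun m t => - g m t) K (fun m hm t ht => (hg m hm t ht).neg)
    (fun t ht => by have := (abs_le.1 (hK t ht)).1; linarith) 1 hone
  have hK0 : 0 ≤ K := (abs_nonneg _).trans (hK 1 hone)
  have hJ : K / (J ! : ℝ) ≤ K :=
    div_le_self hK0 (by exact_mod_cast Nat.one_le_iff_ne_zero.2 (Nat.factorial_ne_zero J))
  simp only [one_pow, mul_one, neg_div, Finset.sum_neg_distrib] at h1 h2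
  rw [abs_le]
  constructor <;> linarith

/-! ### Partial sums of the exponential series under a Gaussian weight -/

/-- The exponential series, with a remainder that is small for negative arguments too. -/
lemma abs_exp_sub_sum_le (x : ℝ) (N : ℕ) :
    |Real.exp x - ∑ i ∈ range N, x ^ i / (i ! : ℝ)| ≤ |x| ^ N * max 1 (Real.exp x) := by
  have h := abs_sub_taylor_le N (fun m t => x ^ m * Real.exp (t * x)) (|x| ^ N * max 1 (Real.exp x))
    (fun m _ t _ => by
      have h := (((hasDerivAt_id t).mul_const x).exp).const_mul (x ^ m)
      refine h.congr_deriv ?_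
      simp only [id]; ring)
    (fun t ht => by
      rw [abs_mul, abs_pow, Real.abs_exp]
      gcongr
      rcases le_total 0 x with hx | hx
      · exact le_max_of_le_right (Real.exp_le_exp.2 (by nlinarith [ht.2]))
      · exact le_max_of_le_left (Real.exp_le_one_iff.2 (by nlinarith [ht.1])))
  simpa using h

lemma abs_pow_sub_pow_le_of_le {a b B : ℝ} (ha : |a| ≤ B) (hb : |b| ≤ B) (t : ℕ) :
    |a ^ t - b ^ t| ≤ t * B ^ (t - 1) * |a - b| := by
  have hB : 0 ≤ B := (abs_nonneg a).trans ha
  rw [← (Commute.all a b).geom_sum₂_mul t, abs_mul]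
  gcongr
  refine (Finset.abs_sum_le_sum_abs _ _).trans ?_
  calc ∑ i ∈ range t, |a ^ i * b ^ (t - 1 - i)| ≤ ∑ i ∈ range t, B ^ (t - 1) := by
        refine Finset.sum_le_sum fun i hi => ?_
        rw [abs_mul, abs_pow, abs_pow]
        calc |a| ^ i * |b| ^ (t - 1 - i) ≤ B ^ i * B ^ (t - 1 - i) := by gcongr
          _ = B ^ (t - 1) := by
            rw [← pow_add]; congr 1; have := Finset.mem_range.1 hi; omega
    _ = t * B ^ (t - 1) := by simp

/-- Replacing the exponent by an approximation, and its exponential by the partial sum of the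
series: if the exponent is of order `ε` and the approximation has an error of order `ε ^ N`, then
the total error is of order `ε ^ N`, with Gaussian tails. -/
lemma abs_exp_sub_partialSum_le {B : ℝ} (hB : 1 ≤ B) (N K : ℕ) {c w ε q S : ℝ} (hc : c ≤ 1 / 2)
    (hw : 0 ≤ w) (hε : 0 ≤ ε) (hε1 : ε ≤ 1)
    (hq : |q| ≤ B * ε * (1 + w) ^ K) (hS : |S| ≤ B * ε * (1 + w) ^ K)
    (hqS : |q - S| ≤ B * ε ^ N * (1 + w) ^ K) (hqc : -(w ^ 2 / 2) + q ≤ -(c * w ^ 2)) :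
    |Real.exp (-(w ^ 2 / 2) + q) - Real.exp (-(w ^ 2 / 2)) * ∑ i ∈ range N, S ^ i / (i ! : ℝ)| ≤
      (1 + N * N) * B ^ N * ε ^ N * (1 + w) ^ (K * N) * Real.exp (-(c * w ^ 2)) := by
  have hw1 : 1 ≤ 1 + w := by linarith
  have h1w : (0 : ℝ) ≤ 1 + w := by linarith
  have hA : 1 ≤ B * (1 + w) ^ K := one_le_mul_of_one_le_of_one_le hB (one_le_pow₀ hw1)
  set A := B * (1 + w) ^ K with hAdef
  have hq' : |q| ≤ ε * A := by rw [hAdef]; linarith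
  have hqA : |q| ≤ A := hq'.trans (mul_le_of_le_one_left (by linarith) hε1)
  have hSA : |S| ≤ A := by
    refine le_trans (b := ε * A) (by rw [hAdef]; linarith) (mul_le_of_le_one_left (by linarith) hε1)
  have hexp : Real.exp (-(w ^ 2 / 2)) ≤ Real.exp (-(c * w ^ 2)) :=
    Real.exp_le_exp.2 (by nlinarith [sq_nonneg w])
  -- The Gaussian factor is moved inside the maximum: each of `exp (-w²/2)` and `exp (-w²/2 + q)` is
  -- at most `exp (-c w²)`, whereas `exp q` alone has no useful bound.
  have e1 : |Real.exp (-(w ^ 2 / 2) + q) -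
      Real.exp (-(w ^ 2 / 2)) * ∑ i ∈ range N, q ^ i / (i ! : ℝ)| ≤
      ε ^ N * A ^ N * Real.exp (-(c * w ^ 2)) := by
    rw [Real.exp_add, ← mul_sub, abs_mul, Real.abs_exp]
    calc _ ≤ Real.exp (-(w ^ 2 / 2)) * (|q| ^ N * max 1 (Real.exp q)) := by
          gcongr; exact abs_exp_sub_sum_le q N
      _ = |q| ^ N * max (Real.exp (-(w ^ 2 / 2))) (Real.exp (-(w ^ 2 / 2) + q)) := by
          rw [Real.exp_add, mul_left_comm, mul_max_of_nonneg _ _ (Real.exp_pos _).le, mul_one]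
      _ ≤ (ε * A) ^ N * Real.exp (-(c * w ^ 2)) := by
          gcongr
          exact max_le hexp (Real.exp_le_exp.2 hqc)
      _ = _ := by rw [mul_pow]
  have e2 : |∑ i ∈ range N, q ^ i / (i ! : ℝ) - ∑ i ∈ range N, S ^ i / (i ! : ℝ)| ≤
      N * N * ε ^ N * A ^ N := by
    rw [← Finset.sum_sub_distrib]
    refine (Finset.abs_sum_le_sum_abs _ _).trans ?_
    calc _ ≤ ∑ i ∈ range N, (N * ε ^ N * A ^ N) := by
          refine Finset.sum_le_sum fun i hi => ?_
          have hiN := Finset.mem_range.1 hi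
          rw [← sub_div, abs_div, Nat.abs_cast]
          refine (div_le_self (abs_nonneg _)
            (by exact_mod_cast Nat.one_le_iff_ne_zero.2 (Nat.factorial_ne_zero i))).trans ?_
          rcases Nat.eq_zero_or_pos i with rfl | hi0
          · simp; positivity
          calc |q ^ i - S ^ i| ≤ i * A ^ (i - 1) * |q - S| := abs_pow_sub_pow_le_of_le hqA hSA i
            _ ≤ N * A ^ (N - 1) * (ε ^ N * A) := by
                gcongr
                rw [hAdef]; linarith
            _ = N * ε ^ N * A ^ N := by
                obtain ⟨m, rfl⟩ : ∃ m, N = m + 1 := ⟨N - 1, by omega⟩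
                rw [Nat.add_sub_cancel]; ring
      _ = _ := by simp; ring
  have hfin : A ^ N = B ^ N * (1 + w) ^ (K * N) := by rw [hAdef, mul_pow, ← pow_mul]
  have e3 : |Real.exp (-(w ^ 2 / 2)) * ∑ i ∈ range N, q ^ i / (i ! : ℝ) -
      Real.exp (-(w ^ 2 / 2)) * ∑ i ∈ range N, S ^ i / (i ! : ℝ)| ≤
      Real.exp (-(c * w ^ 2)) * (N * N * ε ^ N * A ^ N) := by
    rw [← mul_sub, abs_mul, Real.abs_exp]
    gcongr
  calc _ ≤ ε ^ N * A ^ N * Real.exp (-(c * w ^ 2)) +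
        Real.exp (-(c * w ^ 2)) * (N * N * ε ^ N * A ^ N) :=
        (abs_sub_le _ _ _).trans (add_le_add e1 e3)
    _ = _ := by rw [hfin]; ring

/-! ### Multilinear maps on the diagonal -/

lemma sum_smul_e {p : ℕ} (v : Vec p) : ∑ i, v i • e i = v := by
  simpa [e] using (EuclideanSpace.basisFun (Fin p) ℝ).sum_repr v

lemma abs_apply_le_norm {p : ℕ} (v : Vec p) (i : Fin p) : |v i| ≤ ‖v‖ := by
  simpa using PiLp.norm_apply_le v i

lemma multilinear_diag_eq_sum {p m : ℕ} (f : ContinuousMultilinearMap ℝ (fun _ : Fin m => Vec p) ℝ)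
    (v : Vec p) :
    f (fun _ => v) = ∑ i : Fin m → Fin p, f (fun j => e (i j)) * ∏ j, v (i j) := by
  conv_lhs => rw [← sum_smul_e v]
  rw [ContinuousMultilinearMap.map_sum]
  refine Finset.sum_congr rfl fun i _ => ?_
  rw [ContinuousMultilinearMap.map_smul_univ, smul_eq_mul, mul_comm]

/-- Bounds on partial derivatives become bounds on directional ones; the factor counts the `p ^ m`
index tuples. -/
lemma abs_multilinear_diag_le {p m : ℕ}
    (f : ContinuousMultilinearMap ℝ (fun _ : Fin m => Vec p) ℝ) {K : ℝ}
    (hK : ∀ i : Fin m → Fin p, |f (fun j => e (i j))| ≤ K) (v : Vec p) :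
    |f (fun _ => v)| ≤ (p : ℝ) ^ m * K * ‖v‖ ^ m := by
  rw [multilinear_diag_eq_sum]
  refine (Finset.abs_sum_le_sum_abs _ _).trans ?_
  calc _ ≤ ∑ i : Fin m → Fin p, K * ‖v‖ ^ m := by
        refine Finset.sum_le_sum fun i _ => ?_
        rw [abs_mul, Finset.abs_prod]
        have hK0 : 0 ≤ K := (abs_nonneg _).trans (hK i)
        refine mul_le_mul (hK i) ?_ (Finset.prod_nonneg fun _ _ => abs_nonneg _) hK0
        calc ∏ j, |v (i j)| ≤ ∏ _j : Fin m, ‖v‖ :=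
              Finset.prod_le_prod (fun _ _ => abs_nonneg _) fun j _ => abs_apply_le_norm v (i j)
          _ = ‖v‖ ^ m := by simp
    _ = _ := by simp [mul_assoc]

lemma exists_polynomial_multilinear_diag {p m : ℕ}
    (f : ContinuousMultilinearMap ℝ (fun _ : Fin m => Vec p) ℝ) :
    ∃ q : MvPolynomial (Fin p) ℝ, q.totalDegree ≤ m ∧
      ∀ v : Vec p, f (fun _ => v) = MvPolynomial.eval (fun i => v i) q := by
  refine ⟨∑ i : Fin m → Fin p,
    MvPolynomial.C (f (fun j => e (i j))) * ∏ j, MvPolynomial.X (i j), ?_, fun v => ?_⟩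
  · refine MvPolynomial.totalDegree_finsetSum_le fun i _ => ?_
    refine (MvPolynomial.totalDegree_mul _ _).trans ?_
    rw [MvPolynomial.totalDegree_C, zero_add]
    refine (MvPolynomial.totalDegree_finsetProd _ _).trans ?_
    simp
  · rw [multilinear_diag_eq_sum]
    simp

/-! ### Gaussian integrals -/

lemma integrable_exp_neg_mul_sq_norm {p : ℕ} {c : ℝ} (hc : 0 < c) :
    Integrable fun z : Vec p => Real.exp (-(c * ‖z‖ ^ 2)) := by
  have h := GaussianFourier.integrable_cexp_neg_mul_sq_norm_add (V := Vec p) (b := (c : ℂ))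
    (by simpa using hc) 0 0
  refine h.norm.congr (Eventually.of_forall fun z => ?_)
  simp only [Complex.norm_exp]
  congr 1
  have : (-(c : ℂ) * (‖z‖ : ℂ) ^ 2 + 0 * ((inner ℝ 0 z : ℝ) : ℂ)) =
      ((-(c * ‖z‖ ^ 2) : ℝ) : ℂ) := by push_cast; ring
  rw [this, Complex.ofReal_re]

/-- Bound `1 + w` by `exp w` and complete the square: half of the Gaussian exponent absorbs the
polynomial. The explicit constant also serves for `n ^ j * exp (-n b)`. -/
lemma one_add_pow_mul_exp_le {c : ℝ} (hc : 0 < c) (K : ℕ) (w : ℝ) (hw : 0 ≤ w) :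
    (1 + w) ^ K * Real.exp (-(c * w ^ 2)) ≤
      Real.exp (K ^ 2 / (2 * c)) * Real.exp (-(c / 2 * w ^ 2)) := by
  have h1 : (1 + w) ^ K ≤ Real.exp (K * w) := by
    rw [Real.exp_nat_mul]
    gcongr
    linarith [Real.add_one_le_exp w]
  calc _ ≤ Real.exp (K * w) * Real.exp (-(c * w ^ 2)) := by gcongr
    _ ≤ _ := by
      rw [← Real.exp_add, ← Real.exp_add, Real.exp_le_exp]
      have h : (K : ℝ) ^ 2 / (2 * c) + -(c / 2 * w ^ 2) - (K * w + -(c * w ^ 2)) =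
          (K - c * w) ^ 2 / (2 * c) := by field_simp; ring
      have : 0 ≤ ((K : ℝ) - c * w) ^ 2 / (2 * c) := by positivity
      linarith

lemma integrable_one_add_norm_pow_mul_exp {p : ℕ} {c : ℝ} (hc : 0 < c) (K : ℕ) :
    Integrable fun z : Vec p => (1 + ‖z‖) ^ K * Real.exp (-(c * ‖z‖ ^ 2)) := by
  refine ((integrable_exp_neg_mul_sq_norm (p := p) (half_pos hc)).const_mul
    (Real.exp (K ^ 2 / (2 * c)))).mono' (by fun_prop) (Eventually.of_forall fun z => ?_)
  rw [Real.norm_of_nonneg (by positivity)]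
  exact one_add_pow_mul_exp_le hc K _ (norm_nonneg z)

/-! ### The standard normal density and graded polynomials -/

/-- The normalizing constant of the standard normal density. -/
def normConst (p : ℕ) : ℝ := (2 * Real.pi) ^ (-(p : ℝ) / 2)

lemma normConst_pos (p : ℕ) : 0 < normConst p := Real.rpow_pos_of_pos (by positivity) _

lemma stdNormal_eq {p : ℕ} (z : Vec p) :
    stdNormal z = normConst p * Real.exp (-(‖z‖ ^ 2 / 2)) := by
  rw [stdNormal, normConst, neg_div (2 : ℝ) (‖z‖ ^ 2)]

lemma stdNormal_nonneg {p : ℕ} (z : Vec p) : 0 ≤ stdNormal z := by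
  rw [stdNormal_eq]; have := normConst_pos p; positivity

lemma continuous_stdNormal {p : ℕ} : Continuous (stdNormal (p := p)) := by
  have : (stdNormal (p := p)) = fun z => normConst p * Real.exp (-(‖z‖ ^ 2 / 2)) :=
    funext stdNormal_eq
  rw [this]; fun_prop

lemma integrable_stdNormal_mul_pow {p : ℕ} (K : ℕ) :
    Integrable fun z : Vec p => stdNormal z * (1 + ‖z‖) ^ K := by
  refine ((integrable_one_add_norm_pow_mul_exp (p := p) one_half_pos K).const_mul
    (normConst p)).congr (Eventually.of_forall fun z => ?_)
  simp only [stdNormal_eq]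
  rw [show ‖z‖ ^ 2 / 2 = 1 / 2 * ‖z‖ ^ 2 by ring]; ring

/-- `f` is a polynomial of degree at most `3 s` and of the parity of `s`, with growth bounded by
`B (1 + ‖z‖) ^ K`. -/
structure IsGraded {p : ℕ} (s : ℕ) (B : ℝ) (K : ℕ) (f : Vec p → ℝ) : Prop where
  poly : ∃ q : MvPolynomial (Fin p) ℝ, q.totalDegree ≤ 3 * s ∧
    ∀ z : Vec p, f z = MvPolynomial.eval (fun i => z i) q
  parity : ∀ z, f (-z) = (-1) ^ s * f z
  bound : ∀ z, |f z| ≤ B * (1 + ‖z‖) ^ K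

namespace IsGraded

lemma continuous {p s K : ℕ} {B : ℝ} {f : Vec p → ℝ} (hf : IsGraded s B K f) : Continuous f := by
  obtain ⟨q, -, hq⟩ := hf.poly
  rw [funext hq]
  exact (MvPolynomial.continuous_eval q).comp (by fun_prop)

/-- Grades add under products. This is why a degree `j + 3` is recorded only as at most `3 (j + 1)`:
a product of `t` terms gains `2 t` in degree over its power of `ε`, and the worst case `j = 0`
triples it. -/
lemma prod {p t K : ℕ} {B : ℝ} {s : Fin t → ℕ} {f : Fin t → Vec p → ℝ}
    (hf : ∀ i, IsGraded (s i) B K (f i)) :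
    IsGraded (∑ i, s i) (B ^ t) (K * t) (fun z => ∏ i, f i z) where
  poly := by
    choose q hq hfq using fun i => (hf i).poly
    refine ⟨∏ i, q i, ?_, fun z => ?_⟩
    · refine (MvPolynomial.totalDegree_finsetProd _ _).trans ?_
      rw [Finset.mul_sum]
      exact Finset.sum_le_sum fun i _ => hq i
    · rw [map_prod]
      exact Finset.prod_congr rfl fun i _ => hfq i z
  parity z := by
    rw [← Finset.prod_pow_eq_pow_sum, ← Finset.prod_mul_distrib]
    exact Finset.prod_congr rfl fun i _ => (hf i).parity z
  bound z := by
    rw [Finset.abs_prod]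
    calc ∏ i, |f i z| ≤ ∏ _i : Fin t, (B * (1 + ‖z‖) ^ K) :=
          Finset.prod_le_prod (fun _ _ => abs_nonneg _) fun i _ => (hf i).bound z
      _ = _ := by simp [mul_pow, ← pow_mul]

lemma integrable {p s K : ℕ} {B : ℝ} {f : Vec p → ℝ} (hf : IsGraded s B K f) :
    Integrable fun z => stdNormal z * f z := by
  refine ((integrable_stdNormal_mul_pow K).const_mul B).mono'
    (continuous_stdNormal.mul hf.continuous).aestronglyMeasurable (Eventually.of_forall fun z => ?_)
  rw [norm_mul, Real.norm_of_nonneg (stdNormal_nonneg z)]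
  calc _ ≤ stdNormal z * (B * (1 + ‖z‖) ^ K) :=
        mul_le_mul_of_nonneg_left (hf.bound z) (stdNormal_nonneg z)
    _ = _ := by ring

end IsGraded

/-! ### The error functional of a quadrature rule -/

/-- The error of a quadrature rule against the standard normal density. -/
def QuadRule.error {p : ℕ} (R : QuadRule p) (f : Vec p → ℝ) : ℝ :=
  (∫ z, stdNormal z * f z) - ∑ z ∈ R.points, stdNormal z * f z * R.weight z

namespace QuadRule

variable {p : ℕ} (R : QuadRule p)

lemma error_eq_zero_of_odd (hsymm : R.IsSymmetric) {f : Vec p → ℝ} (hf : ∀ z, f (-z) = - f z) :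
    R.error f = 0 := by
  have hφ : ∀ z : Vec p, stdNormal (-z) = stdNormal z := fun z => by simp [stdNormal]
  have h1 : ∫ z, stdNormal z * f z = 0 := by
    have := integral_neg_eq_self (fun z : Vec p => stdNormal z * f z) volume
    simp only [hφ, hf, mul_neg, integral_neg] at this
    linarith
  have h2 : ∑ z ∈ R.points, stdNormal z * f z * R.weight z = 0 := by
    have : ∑ z ∈ R.points, stdNormal z * f z * R.weight z =
        ∑ z ∈ R.points, - (stdNormal z * f z * R.weight z) := by
      refine Finset.sum_nbij' (fun z => -z) (fun z => -z) (fun z hz => (hsymm z hz).1)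
        (fun z hz => (hsymm z hz).1) (fun z _ => neg_neg z) (fun z _ => neg_neg z) fun z hz => ?_
      rw [hφ, hf, ← (hsymm z hz).2]; ring
    rw [Finset.sum_neg_distrib] at this
    linarith
  rw [error, h1, h2, sub_zero]

/-- Odd grades vanish by symmetry, even grades by exactness. An even `s < 2 r` is at most `2 r - 2`,
so the degree is at most `6 r - 6 ≤ 2 k - 2`. -/
lemma error_eq_zero_of_isGraded {k r s K : ℕ} {B : ℝ} (hk : 1 ≤ k) (hr : 3 * r ≤ k + 2)
    (hs : s < 2 * r) (hsymm : R.IsSymmetric) (hexact : R.IsExact k) {f : Vec p → ℝ}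
    (hf : IsGraded s B K f) : R.error f = 0 := by
  rcases Nat.even_or_odd s with hev | hodd
  · obtain ⟨q, hq, hfq⟩ := hf.poly
    obtain ⟨a, rfl⟩ := hev
    have := hexact q (by omega)
    simp only [error, hfq, this, sub_self]
  · exact R.error_eq_zero_of_odd hsymm fun z => by rw [hf.parity, hodd.neg_one_pow]; ring

/-- The total mass of `(1 + ‖z‖) ^ K` under the normal density and the absolute rule. -/
def absMoment (K : ℕ) : ℝ :=
  (∫ z : Vec p, stdNormal z * (1 + ‖z‖) ^ K) +
    ∑ z ∈ R.points, stdNormal z * (1 + ‖z‖) ^ K * |R.weight z|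

lemma absMoment_nonneg (K : ℕ) : 0 ≤ R.absMoment K := by
  refine add_nonneg (integral_nonneg fun z => ?_) (Finset.sum_nonneg fun z _ => ?_)
  · have := stdNormal_nonneg z; positivity
  · have := stdNormal_nonneg z; positivity

lemma abs_error_le {s K : ℕ} {B : ℝ} {f : Vec p → ℝ} (hf : IsGraded s B K f) :
    |R.error f| ≤ B * R.absMoment K := by
  have h1 : |∫ z, stdNormal z * f z| ≤ B * ∫ z : Vec p, stdNormal z * (1 + ‖z‖) ^ K := by
    rw [← integral_const_mul, ← Real.norm_eq_abs]
    refine norm_integral_le_of_norm_le ((integrable_stdNormal_mul_pow K).const_mul B)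
      (Eventually.of_forall fun z => ?_)
    rw [norm_mul, Real.norm_of_nonneg (stdNormal_nonneg z)]
    calc _ ≤ stdNormal z * (B * (1 + ‖z‖) ^ K) :=
          mul_le_mul_of_nonneg_left (hf.bound z) (stdNormal_nonneg z)
      _ = _ := by ring
  have h2 : |∑ z ∈ R.points, stdNormal z * f z * R.weight z| ≤
      B * ∑ z ∈ R.points, stdNormal z * (1 + ‖z‖) ^ K * |R.weight z| := by
    refine (Finset.abs_sum_le_sum_abs _ _).trans ?_
    rw [Finset.mul_sum]
    refine Finset.sum_le_sum fun z _ => ?_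
    rw [abs_mul, abs_mul, abs_of_nonneg (stdNormal_nonneg z)]
    calc _ ≤ stdNormal z * (B * (1 + ‖z‖) ^ K) * |R.weight z| := by
          gcongr
          · exact stdNormal_nonneg z
          · exact hf.bound z
      _ = _ := by ring
  rw [absMoment, mul_add]
  exact (abs_sub _ _).trans (add_le_add h1 h2)

lemma error_sum {ι : Type*} (s : Finset ι) (a : ι → ℝ) (f : ι → Vec p → ℝ)
    (hf : ∀ i ∈ s, Integrable fun z => stdNormal z * f i z) :
    R.error (fun z => ∑ i ∈ s, a i * f i z) = ∑ i ∈ s, a i * R.error (f i) := by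
  have h1 : ∫ z, stdNormal z * ∑ i ∈ s, a i * f i z = ∑ i ∈ s, a i * ∫ z, stdNormal z * f i z := by
    simp only [Finset.mul_sum, ← integral_const_mul]
    rw [← integral_finsetSum _ fun i hi => (hf i hi).const_mul (a i)]
    refine integral_congr_ae (Eventually.of_forall fun z => ?_)
    exact Finset.sum_congr rfl fun i _ => by ring
  rw [error, h1]
  simp only [error, mul_sub, Finset.sum_sub_distrib, Finset.mul_sum, Finset.sum_mul]
  rw [Finset.sum_comm]
  congr 1
  exact Finset.sum_congr rfl fun i _ => Finset.sum_congr rfl fun z _ => by ring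

/-- A constant for `abs_error_partialSum_le`. -/
def errorConst (r : ℕ) (B : ℝ) (K n : ℕ) : ℝ :=
  ∑ t ∈ range (2 * r), (n : ℝ) ^ t * (B ^ t * R.absMoment (K * t))

/-- The rule integrates the exponential series of a graded polynomial in `ε` up to an error of
order `ε ^ (2 r)`. -/
lemma abs_error_partialSum_le {k r K n : ℕ} {B ε : ℝ} (hk : 1 ≤ k) (hr : 3 * r ≤ k + 2)
    (hsymm : R.IsSymmetric) (hexact : R.IsExact k) (hB : 0 ≤ B) (hε : 0 ≤ ε) (hε1 : ε ≤ 1)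
    {b : Fin n → Vec p → ℝ} (hb : ∀ j : Fin n, IsGraded ((j : ℕ) + 1) B K (b j)) :
    (Integrable fun z => stdNormal z *
      ∑ t ∈ range (2 * r), (∑ j : Fin n, ε ^ ((j : ℕ) + 1) * b j z) ^ t / (t ! : ℝ)) ∧
    |R.error fun z =>
      ∑ t ∈ range (2 * r), (∑ j : Fin n, ε ^ ((j : ℕ) + 1) * b j z) ^ t / (t ! : ℝ)| ≤
      R.errorConst r B K n * ε ^ (2 * r) := by
  have hg : ∀ (t : ℕ) (x : Fin t → Fin n),
      IsGraded (∑ i, ((x i : ℕ) + 1)) (B ^ t) (K * t) (fun z => ∏ i, b (x i) z) :=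
    fun t x => IsGraded.prod fun i => hb (x i)
  -- Expand each power over tuples `x : Fin t → Fin n`; the exponent of `ε` is then exactly the
  -- grade of the accompanying product.
  have hexp : ∀ z, ∑ t ∈ range (2 * r), (∑ j : Fin n, ε ^ ((j : ℕ) + 1) * b j z) ^ t / (t ! : ℝ) =
      ∑ a ∈ (range (2 * r)).sigma fun t => (Finset.univ : Finset (Fin t → Fin n)),
        (ε ^ (∑ i, ((a.2 i : ℕ) + 1)) / (a.1 ! : ℝ)) * ∏ i, b (a.2 i) z := by
    intro z
    rw [Finset.sum_sigma]
    refine Finset.sum_congr rfl fun t _ => ?_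
    rw [Fintype.sum_pow, Finset.sum_div]
    refine Finset.sum_congr rfl fun x _ => ?_
    rw [Finset.prod_mul_distrib, Finset.prod_pow_eq_pow_sum]
    ring
  simp only [hexp]
  constructor
  · simp only [Finset.mul_sum]
    refine integrable_finsetSum _ fun a _ => ?_
    refine ((hg a.1 a.2).integrable.const_mul (ε ^ (∑ i, ((a.2 i : ℕ) + 1)) / (a.1 ! : ℝ))).congr
      (Eventually.of_forall fun z => ?_)
    simp only []
    ring
  · rw [R.error_sum _ _ (fun (a : Σ t, Fin t → Fin n) z => ∏ i, b (a.2 i) z)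
      fun a _ => (hg a.1 a.2).integrable]
    refine (Finset.abs_sum_le_sum_abs _ _).trans ?_
    rw [errorConst, Finset.sum_mul, Finset.sum_sigma]
    refine Finset.sum_le_sum fun t _ => ?_
    calc _ ≤ ∑ x : Fin t → Fin n, (B ^ t * R.absMoment (K * t)) * ε ^ (2 * r) := by
          refine Finset.sum_le_sum fun x _ => ?_
          have hm := R.absMoment_nonneg (K * t)
          -- Grades below `2 r` contribute nothing; for the others the power of `ε` alone is at most
          -- `ε ^ (2 r)`.
          rcases lt_or_ge (∑ i, ((x i : ℕ) + 1)) (2 * r) with hlt | hge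
          · rw [R.error_eq_zero_of_isGraded hk hr hlt hsymm hexact (hg t x)]
            simp; positivity
          · rw [abs_mul, abs_div, abs_pow, abs_of_nonneg hε, Nat.abs_cast, mul_comm]
            refine mul_le_mul (R.abs_error_le (hg t x)) ?_ (by positivity) (by positivity)
            refine (div_le_self (by positivity)
              (by exact_mod_cast Nat.one_le_iff_ne_zero.2 (Nat.factorial_ne_zero t))).trans ?_
            exact pow_le_pow_of_le_one hε hε1 hge
      _ = _ := by simp; ring

end QuadRule

/-! ### Quadrature of a perturbed Gaussian -/

lemma abs_sum_pow_mul_le {p n K : ℕ} {B ε : ℝ} (hB : 0 ≤ B) (hε : 0 ≤ ε) (hε1 : ε ≤ 1)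
    {b : Fin n → Vec p → ℝ} (hb : ∀ j : Fin n, IsGraded ((j : ℕ) + 1) B K (b j)) (z : Vec p) :
    |∑ j : Fin n, ε ^ ((j : ℕ) + 1) * b j z| ≤ ((n + 1) * B) * ε * (1 + ‖z‖) ^ K := by
  refine (Finset.abs_sum_le_sum_abs _ _).trans ?_
  calc _ ≤ ∑ _j : Fin n, ε * (B * (1 + ‖z‖) ^ K) := by
        refine Finset.sum_le_sum fun j _ => ?_
        rw [abs_mul, abs_pow, abs_of_nonneg hε]
        refine mul_le_mul ?_ ((hb j).bound z) (abs_nonneg _) hε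
        exact (pow_le_pow_of_le_one hε hε1 (Nat.le_add_left 1 j)).trans_eq (pow_one ε)
    _ = n * (ε * (B * (1 + ‖z‖) ^ K)) := by simp
    _ ≤ (n + 1) * (ε * (B * (1 + ‖z‖) ^ K)) := by gcongr; linarith
    _ = _ := by ring

lemma abs_partialSum_le {S A : ℝ} (hA : 1 ≤ A) (hS : |S| ≤ A) (N : ℕ) :
    |∑ t ∈ range N, S ^ t / (t ! : ℝ)| ≤ N * A ^ N := by
  refine (Finset.abs_sum_le_sum_abs _ _).trans ?_
  calc _ ≤ ∑ _t ∈ range N, A ^ N := by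
        refine Finset.sum_le_sum fun t ht => ?_
        rw [abs_div, abs_pow, Nat.abs_cast]
        refine (div_le_self (by positivity)
          (by exact_mod_cast Nat.one_le_iff_ne_zero.2 (Nat.factorial_ne_zero t))).trans ?_
        calc |S| ^ t ≤ A ^ t := by gcongr
          _ ≤ A ^ N := pow_le_pow_right₀ hA (Finset.mem_range.1 ht).le
    _ = _ := by simp

/-- The perturbed Gaussian on `U` is pointwise approximated by the Gaussian times the partial sum of
the exponential series of the approximate perturbation, even outside `U`. -/
lemma abs_indicator_sub_partialSum_le {p n K N : ℕ} {B c ρ ε : ℝ} (hB : 1 ≤ B) (hc1 : c ≤ 1 / 2)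
    (hρ : 0 < ρ) (hε : 0 ≤ ε) (hε1 : ε ≤ 1) {b : Fin n → Vec p → ℝ}
    (hb : ∀ j : Fin n, IsGraded ((j : ℕ) + 1) B K (b j)) {U : Set (Vec p)} {q : Vec p → ℝ}
    (hU : ∀ z, ε * ‖z‖ < ρ → z ∈ U)
    (hq : ∀ z ∈ U, |q z| ≤ B * ε * (1 + ‖z‖) ^ K)
    (hqS : ∀ z ∈ U, |q z - ∑ j : Fin n, ε ^ ((j : ℕ) + 1) * b j z| ≤ B * ε ^ N * (1 + ‖z‖) ^ K)
    (hqc : ∀ z ∈ U, -(‖z‖ ^ 2 / 2) + q z ≤ -(c * ‖z‖ ^ 2)) (z : Vec p) :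
    |U.indicator (fun z => Real.exp (-(‖z‖ ^ 2 / 2) + q z)) z - Real.exp (-(‖z‖ ^ 2 / 2)) *
        ∑ t ∈ range N, (∑ j : Fin n, ε ^ ((j : ℕ) + 1) * b j z) ^ t / (t ! : ℝ)| ≤
      ((1 + N * N) * ((n + 1) * B) ^ N + N * ((n + 1) * B) ^ N / ρ ^ N) * ε ^ N *
        ((1 + ‖z‖) ^ (K * N + N) * Real.exp (-(c * ‖z‖ ^ 2))) := by
  set S := ∑ j : Fin n, ε ^ ((j : ℕ) + 1) * b j z with hSdef
  have hB0 : 0 ≤ B := by linarith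
  set B' : ℝ := (n + 1) * B with hB'
  have hBB' : B ≤ B' := by
    have : 0 ≤ (n : ℝ) * B := by positivity
    rw [hB']; linarith
  have hB'1 : 1 ≤ B' := hB.trans hBB'
  have hS : |S| ≤ B' * ε * (1 + ‖z‖) ^ K := abs_sum_pow_mul_le hB0 hε hε1 hb z
  have hw : 0 ≤ ‖z‖ := norm_nonneg z
  have hw1 : 1 ≤ 1 + ‖z‖ := by linarith
  have hpow : (1 + ‖z‖) ^ (K * N) ≤ (1 + ‖z‖) ^ (K * N + N) :=
    pow_le_pow_right₀ hw1 (Nat.le_add_right _ _)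
  by_cases hz : z ∈ U
  · rw [Set.indicator_of_mem hz]
    have h := abs_exp_sub_partialSum_le hB'1 N K (c := c) (w := ‖z‖) (ε := ε) (q := q z) (S := S)
      hc1 hw hε hε1 ((hq z hz).trans (by gcongr)) hS
      ((hqS z hz).trans (by gcongr)) (hqc z hz)
    refine h.trans ?_
    calc _ ≤ (1 + N * N) * B' ^ N * ε ^ N * (1 + ‖z‖) ^ (K * N + N) *
          Real.exp (-(c * ‖z‖ ^ 2)) := by gcongr
      _ = (1 + N * N) * B' ^ N * ε ^ N * ((1 + ‖z‖) ^ (K * N + N) *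
          Real.exp (-(c * ‖z‖ ^ 2))) := by ring
      _ ≤ _ := by
          gcongr
          exact le_add_of_nonneg_right (by positivity)
  · rw [Set.indicator_of_notMem hz, zero_sub, abs_neg, abs_mul, Real.abs_exp]
    have hz' : ρ ≤ ε * ‖z‖ := not_lt.1 fun h => hz (hU z h)
    -- Outside `U` one has `ρ ≤ ε ‖z‖`, so `N` factors `ε (1 + ‖z‖) / ρ ≥ 1` can be inserted; the
    -- extra polynomial growth is absorbed by the Gaussian.
    have hone : 1 ≤ ε ^ N * (1 + ‖z‖) ^ N / ρ ^ N := by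
      rw [one_le_div (by positivity), ← mul_pow]
      gcongr
      nlinarith
    have hA : 1 ≤ B' * (1 + ‖z‖) ^ K := one_le_mul_of_one_le_of_one_le hB'1 (one_le_pow₀ hw1)
    have hT := abs_partialSum_le hA (hS.trans (by
      gcongr
      exact mul_le_of_le_one_right (by linarith) hε1)) N
    have hexp : Real.exp (-(‖z‖ ^ 2 / 2)) ≤ Real.exp (-(c * ‖z‖ ^ 2)) :=
      Real.exp_le_exp.2 (by nlinarith [sq_nonneg ‖z‖])
    calc _ ≤ Real.exp (-(c * ‖z‖ ^ 2)) * (N * (B' * (1 + ‖z‖) ^ K) ^ N) := by gcongr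
      _ = Real.exp (-(c * ‖z‖ ^ 2)) * (N * (B' * (1 + ‖z‖) ^ K) ^ N) * 1 := by ring
      _ ≤ Real.exp (-(c * ‖z‖ ^ 2)) * (N * (B' * (1 + ‖z‖) ^ K) ^ N) *
          (ε ^ N * (1 + ‖z‖) ^ N / ρ ^ N) := by gcongr
      _ = (N * B' ^ N / ρ ^ N) * ε ^ N * ((1 + ‖z‖) ^ (K * N + N) *
          Real.exp (-(c * ‖z‖ ^ 2))) := by rw [mul_pow, ← pow_mul, pow_add]; ring
      _ ≤ _ := by
          gcongr
          exact le_add_of_nonneg_left (by positivity)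

set_option maxHeartbeats 800000 in
/-- Quadrature of a perturbed Gaussian density: if the perturbation is of order `ε` and agrees up to
`ε ^ (2 r)` with a graded polynomial in `ε`, then so does the integral with its quadrature. -/
theorem QuadRule.exists_abs_integral_sub_sum_le {p : ℕ} (R : QuadRule p) {k r : ℕ} (hk : 1 ≤ k)
    (hr1 : 1 ≤ r) (hr : 3 * r ≤ k + 2) (hsymm : R.IsSymmetric) (hexact : R.IsExact k)
    (n K : ℕ) {B c ρ : ℝ} (hB : 1 ≤ B) (hc : 0 < c) (hc1 : c ≤ 1 / 2) (hρ : 0 < ρ) :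
    ∃ C > (0 : ℝ), ∃ κ > (0 : ℝ), ∃ ε₀ > (0 : ℝ), ∀ ε : ℝ, 0 < ε → ε ≤ ε₀ →
      ∀ (b : Fin n → Vec p → ℝ) (U : Set (Vec p)) (q : Vec p → ℝ),
      (∀ j : Fin n, IsGraded ((j : ℕ) + 1) B K (b j)) → MeasurableSet U → ContinuousOn q U →
      (∀ z, ε * ‖z‖ < ρ → z ∈ U) →
      (∀ z ∈ U, |q z| ≤ B * ε * (1 + ‖z‖) ^ K) →
      (∀ z ∈ U, |q z - ∑ j : Fin n, ε ^ ((j : ℕ) + 1) * b j z| ≤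
        B * ε ^ (2 * r) * (1 + ‖z‖) ^ K) →
      (∀ z ∈ U, -(‖z‖ ^ 2 / 2) + q z ≤ -(c * ‖z‖ ^ 2)) →
      IntegrableOn (fun z => Real.exp (-(‖z‖ ^ 2 / 2) + q z)) U ∧
      (∀ z ∈ R.points, z ∈ U) ∧
      |(∫ z in U, Real.exp (-(‖z‖ ^ 2 / 2) + q z)) -
        ∑ z ∈ R.points, Real.exp (-(‖z‖ ^ 2 / 2) + q z) * R.weight z| ≤ C * ε ^ (2 * r) ∧
      κ ≤ ∑ z ∈ R.points, Real.exp (-(‖z‖ ^ 2 / 2) + q z) * R.weight z := by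
  set N := 2 * r with hN
  set A : ℝ := (1 + N * N) * ((n + 1) * B) ^ N + N * ((n + 1) * B) ^ N / ρ ^ N with hA
  have hA0 : 0 ≤ A := by positivity
  set W : Vec p → ℝ := fun z => (1 + ‖z‖) ^ (K * N + N) * Real.exp (-(c * ‖z‖ ^ 2)) with hW
  have hW0 : ∀ z, 0 ≤ W z := fun z => by positivity
  have hWint : Integrable W := integrable_one_add_norm_pow_mul_exp hc _
  -- The summands bound, in turn, the pointwise error integrated, the pointwise error summed over
  -- the nodes, and the error of the rule on the partial sum; the final `1` makes `C` positive.
  set C : ℝ := A * (∫ z, W z) + A * (∑ z ∈ R.points, W z * |R.weight z|) +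
    |(normConst p)⁻¹ * R.errorConst r B K n| + 1 with hC
  have hCpos : 0 < C := by
    have h1 : 0 ≤ ∫ z, W z := integral_nonneg hW0
    have h2 : 0 ≤ ∑ z ∈ R.points, W z * |R.weight z| :=
      Finset.sum_nonneg fun z _ => mul_nonneg (hW0 z) (abs_nonneg _)
    positivity
  set κ : ℝ := volume.real (Metric.ball (0 : Vec p) 1) * Real.exp (-(1 / 2) - B * 2 ^ K) with hκ
  have hκpos : 0 < κ := by
    refine mul_pos ?_ (Real.exp_pos _)
    exact ENNReal.toReal_pos (Metric.measure_ball_pos volume _ one_pos).ne' measure_ball_lt_top.ne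
  set Z : ℝ := ∑ z ∈ R.points, ‖z‖ with hZ
  have hZ0 : 0 ≤ Z := Finset.sum_nonneg fun z _ => norm_nonneg z
  -- The three constraints on `ε`: it is at most one, all nodes lie in `U`, and `C ε ≤ κ / 2`, so
  -- that the sum keeps half of the lower bound `κ` of the integral.
  refine ⟨C, hCpos, κ / 2, half_pos hκpos, min (min 1 (ρ / (Z + 1))) (κ / (2 * C)),
    by positivity, ?_⟩
  intro ε hε hε0 b U q hb hUm hqcont hU hq hqS hqc
  have hε1 : ε ≤ 1 := hε0.trans ((min_le_left _ _).trans (min_le_left _ _))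
  have hεZ : ε * (Z + 1) ≤ ρ := by
    rw [← le_div_iff₀ (by linarith)]
    exact hε0.trans ((min_le_left _ _).trans (min_le_right _ _))
  have hεκ : C * ε ≤ κ / 2 := by
    have : ε ≤ κ / (2 * C) := hε0.trans (min_le_right _ _)
    rw [le_div_iff₀ (by positivity)] at this
    linarith
  have hpts : ∀ z ∈ R.points, z ∈ U := fun z hz => hU z (by
    have : ‖z‖ ≤ Z := Finset.single_le_sum (f := fun z : Vec p => ‖z‖)
      (fun z _ => norm_nonneg z) hz
    nlinarith)
  set T : Vec p → ℝ := fun z =>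
    ∑ t ∈ range N, (∑ j : Fin n, ε ^ ((j : ℕ) + 1) * b j z) ^ t / (t ! : ℝ) with hT
  set F : Vec p → ℝ := fun z => Real.exp (-(‖z‖ ^ 2 / 2) + q z) with hF
  set g : Vec p → ℝ := fun z => Real.exp (-(‖z‖ ^ 2 / 2)) * T z with hg
  have hgφ : ∀ z, g z = (normConst p)⁻¹ * (stdNormal z * T z) := fun z => by
    rw [stdNormal_eq, hg]
    have := (normConst_pos p).ne'
    field_simp
  obtain ⟨hTint, hTerr⟩ := R.abs_error_partialSum_le hk hr hsymm hexact (by linarith) hε.le hε1 hb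
  have hgint : Integrable g := by
    rw [funext hgφ]; exact hTint.const_mul _
  have hpt : ∀ z, |U.indicator F z - g z| ≤ A * ε ^ N * W z :=
    abs_indicator_sub_partialSum_le hB hc1 hρ hε.le hε1 hb hU hq hqS hqc
  have hFmeas : AEStronglyMeasurable (U.indicator F) volume := by
    rw [aestronglyMeasurable_indicator_iff hUm]
    refine ContinuousOn.aestronglyMeasurable ?_ hUm
    exact Real.continuous_exp.comp_continuousOn
      (ContinuousOn.add (by fun_prop) hqcont)
  have hdiff : Integrable fun z => U.indicator F z - g z :=
    (hWint.const_mul (A * ε ^ N)).mono' (hFmeas.sub hgint.aestronglyMeasurable)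
      (Eventually.of_forall fun z => hpt z)
  have hFint : Integrable (U.indicator F) := by
    refine (hdiff.add hgint).congr (Eventually.of_forall fun z => ?_)
    simp
  have hFon : IntegrableOn F U := (integrable_indicator_iff hUm).1 hFint
  have h1 : |(∫ z in U, F z) - ∫ z, g z| ≤ A * (∫ z, W z) * ε ^ N := by
    rw [← integral_indicator hUm, ← integral_sub hFint hgint, ← Real.norm_eq_abs]
    calc _ ≤ ∫ z, A * ε ^ N * W z :=
          norm_integral_le_of_norm_le (hWint.const_mul _) (Eventually.of_forall fun z => hpt z)
      _ = _ := by rw [integral_const_mul]; ring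
  have h2 : |∑ z ∈ R.points, g z * R.weight z - ∑ z ∈ R.points, F z * R.weight z| ≤
      A * (∑ z ∈ R.points, W z * |R.weight z|) * ε ^ N := by
    rw [← Finset.sum_sub_distrib]
    refine (Finset.abs_sum_le_sum_abs _ _).trans ?_
    rw [Finset.mul_sum, Finset.sum_mul]
    refine Finset.sum_le_sum fun z hz => ?_
    rw [← sub_mul, abs_mul, abs_sub_comm]
    have := hpt z
    rw [Set.indicator_of_mem (hpts z hz)] at this
    calc _ ≤ A * ε ^ N * W z * |R.weight z| := by gcongr
      _ = _ := by ring
  have h3 : |(∫ z, g z) - ∑ z ∈ R.points, g z * R.weight z| ≤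
      |(normConst p)⁻¹ * R.errorConst r B K n| * ε ^ N := by
    have : (∫ z, g z) - ∑ z ∈ R.points, g z * R.weight z = (normConst p)⁻¹ * R.error T := by
      simp only [hgφ, QuadRule.error, integral_const_mul, mul_sub, Finset.mul_sum, mul_assoc]
    rw [this, abs_mul, abs_mul, mul_assoc]
    gcongr
    refine hTerr.trans ?_
    gcongr
    exact le_abs_self _
  have hmain : |(∫ z in U, F z) - ∑ z ∈ R.points, F z * R.weight z| ≤ C * ε ^ N := by
    have h4 := abs_sub_le (∫ z in U, F z) (∫ z, g z) (∑ z ∈ R.points, F z * R.weight z)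
    have h5 := abs_sub_le (∫ z, g z) (∑ z ∈ R.points, g z * R.weight z)
      (∑ z ∈ R.points, F z * R.weight z)
    have h6 : 0 ≤ ε ^ N := by positivity
    rw [hC]
    linarith
  -- On the unit ball the exponent is at least `-1/2 - B * 2 ^ K`; the integrand is positive
  -- elsewhere.
  have hlow : κ ≤ ∫ z in U, F z := by
    have hball : Metric.ball (0 : Vec p) 1 ⊆ U := fun z hz => hU z (by
      have : ‖z‖ < 1 := by simpa using hz
      nlinarith)
    have hc' : ∀ z ∈ Metric.ball (0 : Vec p) 1, Real.exp (-(1 / 2) - B * 2 ^ K) ≤ F z := by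
      intro z hz
      have hz1 : ‖z‖ < 1 := by simpa using hz
      refine Real.exp_le_exp.2 ?_
      have h1 : |q z| ≤ B * 2 ^ K := (hq z (hball hz)).trans (by
        have : (1 + ‖z‖) ^ K ≤ 2 ^ K := by gcongr; linarith
        calc B * ε * (1 + ‖z‖) ^ K ≤ B * 1 * 2 ^ K := by gcongr
          _ = _ := by ring)
      have h2 := (abs_le.1 h1).1
      have h3 : ‖z‖ ^ 2 ≤ 1 := by nlinarith [norm_nonneg z]
      linarith
    calc κ = ∫ z in Metric.ball (0 : Vec p) 1, Real.exp (-(1 / 2) - B * 2 ^ K) := by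
          rw [setIntegral_const, smul_eq_mul]
      _ ≤ ∫ z in Metric.ball (0 : Vec p) 1, F z :=
          setIntegral_mono_on (integrableOn_const measure_ball_lt_top.ne)
            (hFon.mono_set hball) measurableSet_ball hc'
      _ ≤ ∫ z in U, F z := setIntegral_mono_set hFon
          (Eventually.of_forall fun z => (Real.exp_pos _).le) hball.eventuallyLE
  refine ⟨hFon, hpts, hmain, ?_⟩
  have hεN : ε ^ N ≤ ε :=
    (pow_le_pow_of_le_one hε.le hε1 (show 1 ≤ N by omega)).trans_eq (pow_one ε)
  have h7 := (abs_le.1 hmain).2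
  have h8 : C * ε ^ N ≤ κ / 2 := (mul_le_mul_of_nonneg_left hεN hCpos.le).trans hεκ
  linarith

/-! ### Cholesky factors -/

-- Take the factorization `A = l D lᵀ` and split `D` into square roots.
open Matrix in
lemma exists_isCholesky {p : ℕ} {A : Matrix (Fin p) (Fin p) ℝ} (hA : A.PosDef) :
    ∃ L, IsCholesky A L := by
  set l := LDL.lower hA with hl
  have htri : l.IsLowerTriangular := by
    refine blockTriangular_inv_of_blockTriangular (M := LDL.lowerInv hA) ?_
    intro i j hij
    exact LDL.lowerInv_triangular hA hij
  have hunit : IsUnit l := by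
    rw [hl, LDL.lower, Matrix.isUnit_nonsing_inv_iff]
    exact isUnit_of_invertible _
  have hdet : l.det ≠ 0 := ((Matrix.isUnit_iff_isUnit_det l).1 hunit).ne_zero
  have hdiag : ∀ i, l i i ≠ 0 := by
    rw [det_of_isLowerTriangular l htri, Finset.prod_ne_zero_iff] at hdet
    exact fun i => hdet i (Finset.mem_univ i)
  set D := LDL.diagEntries hA with hD
  have hpos : ∀ i, 0 < D i := by
    have h : (LDL.diag hA).PosDef := by
      rw [LDL.diag_eq_lowerInv_conj hA]
      refine hA.mul_mul_conjTranspose_same ?_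
      exact Matrix.vecMul_injective_of_isUnit (isUnit_of_invertible _)
    intro i
    simpa [LDL.diag] using h.diag_pos (i := i)
  have hprod : l * diagonal D * lᵀ = A := by
    simpa [LDL.diag, conjTranspose_eq_transpose_of_trivial] using LDL.lower_conj_diag hA
  -- The signs make the diagonal positive and cancel in the product, so it is enough to know that
  -- the diagonal of `l` does not vanish.
  refine ⟨l * diagonal fun i => (SignType.sign (l i i) : ℝ) * √(D i), ?_, ?_, ?_⟩
  · intro i j hij
    rw [mul_diagonal, htri hij, zero_mul]
  · intro i
    rw [mul_diagonal, ← mul_assoc, self_mul_sign]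
    have := hpos i
    have := abs_pos.2 (hdiag i)
    positivity
  · rw [transpose_mul, diagonal_transpose, ← Matrix.mul_assoc, Matrix.mul_assoc l,
      diagonal_mul_diagonal, ← hprod]
    congr 3
    funext i
    have h1 : (SignType.sign (l i i) : ℝ) * SignType.sign (l i i) = 1 := by
      rcases lt_or_gt_of_ne (hdiag i) with h | h <;> simp [h]
    calc _ = ((SignType.sign (l i i) : ℝ) * SignType.sign (l i i)) * (√(D i) * √(D i)) := by ring
      _ = D i := by rw [h1, Real.mul_self_sqrt (hpos i).le, one_mul]

lemma isCholesky_cholesky {p : ℕ} {A : Matrix (Fin p) (Fin p) ℝ} (hA : A.PosDef) :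
    IsCholesky A (cholesky A) := by
  have h := exists_isCholesky hA
  rw [cholesky, dif_pos h]
  exact h.choose_spec

lemma IsCholesky.det_pos {p : ℕ} {A L : Matrix (Fin p) (Fin p) ℝ} (h : IsCholesky A L) :
    0 < L.det := by
  rw [Matrix.det_of_isLowerTriangular L fun i j hij => h.1 i j hij]
  exact Finset.prod_pos fun i _ => h.2.1 i

lemma IsCholesky.transpose_mul_mul {p : ℕ} {H L : Matrix (Fin p) (Fin p) ℝ} (hH : H.PosDef)
    (h : IsCholesky H⁻¹ L) : L.transpose * H * L = 1 := by
  rw [mul_eq_one_comm, ← Matrix.mul_assoc, h.2.2]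
  exact Matrix.nonsing_inv_mul H hH.det_pos.ne'.isUnit

open Matrix in
lemma IsCholesky.dotProduct_mulVec_self {p : ℕ} {H L : Matrix (Fin p) (Fin p) ℝ} (hH : H.PosDef)
    (h : IsCholesky H⁻¹ L) (z : Fin p → ℝ) : (L *ᵥ z) ⬝ᵥ (H *ᵥ (L *ᵥ z)) = z ⬝ᵥ z := by
  have h1 : Lᵀ *ᵥ (H *ᵥ (L *ᵥ z)) = z := by
    rw [mulVec_mulVec, mulVec_mulVec, h.transpose_mul_mul hH, one_mulVec]
  rw [← vecMul_transpose, ← dotProduct_mulVec, vecMul_transpose, h1]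

lemma dotProduct_self_eq_norm_sq {p : ℕ} (x : Vec p) : x.ofLp ⬝ᵥ x.ofLp = ‖x‖ ^ 2 := by
  rw [EuclideanSpace.norm_sq_eq]
  simp [dotProduct, sq]

/-! ### Quadratic forms with bounded spectrum -/

section Spectrum

variable {p : ℕ} {H : Matrix (Fin p) (Fin p) ℝ} {a b : ℝ}

/-- Subtracting the scalar `a` shifts the spectrum to the nonnegative reals, so `H - a` is positive
semidefinite. -/
lemma mul_norm_sq_le_of_spectrum (hH : H.IsHermitian) (hs : ∀ μ ∈ spectrum ℝ H, a ≤ μ)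
    (x : Vec p) : a * ‖x‖ ^ 2 ≤ x.ofLp ⬝ᵥ H.mulVec x.ofLp := by
  have h : (H - algebraMap ℝ _ a).PosSemidef := by
    rw [Matrix.posSemidef_iff_isHermitian_and_spectrum_nonneg, ← spectrum.sub_singleton_eq]
    refine ⟨hH.sub ?_, ?_⟩
    · rw [Matrix.algebraMap_eq_diagonal]
      exact Matrix.isHermitian_diagonal _
    · rintro _ ⟨μ, hμ, _, rfl, rfl⟩
      simpa using hs μ hμ
  have := h.dotProduct_mulVec_nonneg x.ofLp
  rw [Matrix.algebraMap_eq_diagonal] at this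
  simp only [Matrix.sub_mulVec, dotProduct_sub, star_trivial] at this
  have h2 : x.ofLp ⬝ᵥ (Matrix.diagonal (algebraMap ℝ (Fin p → ℝ) a)).mulVec x.ofLp =
      a * ‖x‖ ^ 2 := by
    rw [← dotProduct_self_eq_norm_sq, ← smul_eq_mul, ← dotProduct_smul]
    congr 1
    ext i
    simp [Matrix.mulVec_diagonal]
  linarith

lemma le_mul_norm_sq_of_spectrum (hH : H.IsHermitian) (hs : ∀ μ ∈ spectrum ℝ H, μ ≤ b)
    (x : Vec p) : x.ofLp ⬝ᵥ H.mulVec x.ofLp ≤ b * ‖x‖ ^ 2 := by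
  have h := mul_norm_sq_le_of_spectrum (H := -H) (a := -b) hH.neg (fun μ hμ => by
    rw [← spectrum.neg_eq] at hμ
    have := hs (-μ) hμ
    linarith) x
  simp only [Matrix.neg_mulVec, dotProduct_neg] at h
  linarith

lemma posDef_of_spectrum (hH : H.IsHermitian) (ha : 0 < a) (hs : ∀ μ ∈ spectrum ℝ H, a ≤ μ) :
    H.PosDef :=
  hH.posDef_iff_eigenvalues_pos.2 fun i => ha.trans_le (hs _ (hH.eigenvalues_mem_spectrum_real i))

lemma det_le_of_spectrum (hH : H.IsHermitian) (ha : 0 ≤ a)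
    (hs : ∀ μ ∈ spectrum ℝ H, a ≤ μ ∧ μ ≤ b) :
    H.det ≤ b ^ p := by
  rw [hH.det_eq_prod_eigenvalues]
  have hm := fun i => hs _ (hH.eigenvalues_mem_spectrum_real i)
  calc ∏ i, ((hH.eigenvalues i : ℝ)) ≤ ∏ _i : Fin p, b :=
        Finset.prod_le_prod (fun i _ => ha.trans (hm i).1) fun i _ => (hm i).2
    _ = b ^ p := by simp

/-- Since `(det L)² det H = 1`, the inverse determinant is the square root of `det H`. The crude `x
≤ 1 + x ^ 2` avoids the root; it is enough because an exponentially small factor multiplies it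
later. -/
lemma IsCholesky.inv_det_le {L : Matrix (Fin p) (Fin p) ℝ} (hH : H.PosDef) (h : IsCholesky H⁻¹ L)
    (ha : 0 ≤ a) (hs : ∀ μ ∈ spectrum ℝ H, a ≤ μ ∧ μ ≤ b) : L.det⁻¹ ≤ 1 + b ^ p := by
  have h1 : L.det ^ 2 * H.det = 1 := by
    have := congrArg Matrix.det (h.transpose_mul_mul hH)
    rw [Matrix.det_mul, Matrix.det_mul, Matrix.det_transpose, Matrix.det_one] at this
    linarith
  have h2 := det_le_of_spectrum hH.1 ha hs
  have hpos := h.det_pos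
  have h3 : H.det = L.det⁻¹ ^ 2 := by
    field_simp
    linarith
  nlinarith [sq_nonneg (L.det⁻¹ - 1)]

end Spectrum

/-! ### The affine change of variables -/

/-- The affine change of variables `z ↦ L z + m`. -/
lemma setIntegral_affine {p : ℕ} {L : Matrix (Fin p) (Fin p) ℝ} (hL : 0 < L.det) (m : Vec p)
    {V : Set (Vec p)} (hV : MeasurableSet V) (f : Vec p → ℝ) :
    ∫ θ in V, f θ = L.det *
      ∫ z in {z : Vec p | WithLp.toLp 2 (L.mulVec z) + m ∈ V},
        f (WithLp.toLp 2 (L.mulVec z) + m) := by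
  set A : Vec p →L[ℝ] Vec p := LinearMap.toContinuousLinearMap (Matrix.toLpLin 2 2 L) with hA
  have hAz : ∀ z, A z = WithLp.toLp 2 (L.mulVec z) := fun z => rfl
  have hdet : A.det = L.det := LinearMap.det_toLpLin 2 L
  have hbij : Function.Bijective A := by
    have hu : IsUnit (Matrix.toLpLin 2 2 L : Vec p →ₗ[ℝ] Vec p) := by
      rw [LinearMap.isUnit_iff_isUnit_det, LinearMap.det_toLpLin]
      exact hL.ne'.isUnit
    exact (Module.End.isUnit_iff _).1 hu
  set ψ : Vec p → Vec p := fun z => A z + m with hψ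
  have himg : ψ '' {z | ψ z ∈ V} = V := by
    rw [show {z | ψ z ∈ V} = ψ ⁻¹' V from rfl]
    refine Set.image_preimage_eq V fun y => ?_
    obtain ⟨z, hz⟩ := hbij.2 (y - m)
    exact ⟨z, by simp [hψ, hz]⟩
  have hm : MeasurableSet {z | ψ z ∈ V} := hV.preimage (by fun_prop : Continuous ψ).measurable
  have h := integral_image_eq_integral_abs_det_fderiv_smul volume (f := ψ) (f' := fun _ => A) hm
    (fun z _ => (A.hasFDerivAt.add_const m).hasFDerivWithinAt)
    (fun x _ y _ hxy => hbij.1 (by simpa [hψ] using hxy)) f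
  rw [himg] at h
  rw [h]
  simp only [hdet, abs_of_pos hL, smul_eq_mul, integral_const_mul]
  rfl

/-! ### Taylor expansion along lines -/

section Line

variable {p D : ℕ} {f : Vec p → ℝ} {V : Set (Vec p)}

lemma hasDerivAt_iteratedFDeriv_line (hV : IsOpen V) (hD : DiffTimesOn D f V) {m : ℕ} (hm : m < D)
    {x v : Vec p} {t : ℝ} (ht : x + t • v ∈ V) :
    HasDerivAt (fun t : ℝ => iteratedFDeriv ℝ m f (x + t • v) (fun _ => v))
      (iteratedFDeriv ℝ (m + 1) f (x + t • v) (fun _ => v)) t := by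
  have h1 : HasFDerivAt (iteratedFDeriv ℝ m f) (fderiv ℝ (iteratedFDeriv ℝ m f) (x + t • v))
      (x + t • v) := ((hD m hm).differentiableAt (hV.mem_nhds ht)).hasFDerivAt
  have h2 : HasDerivAt (fun t : ℝ => x + t • v) v t := by
    simpa using ((hasDerivAt_id t).smul_const v).const_add x
  have h3 := h1.comp_hasDerivAt t h2
  have h4 := (ContinuousMultilinearMap.apply ℝ (fun _ : Fin m => Vec p) ℝ
    (fun _ => v)).hasFDerivAt.comp_hasDerivAt t h3
  rw [iteratedFDeriv_succ_apply_left]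
  exact h4

lemma line_mem (hVc : Convex ℝ V) {x v : Vec p} (hx : x ∈ V) (hxv : x + v ∈ V) {t : ℝ}
    (ht : t ∈ Set.Icc (0 : ℝ) 1) : x + t • v ∈ V := by
  have := hVc.add_smul_sub_mem hx hxv ht
  simpa using this

lemma abs_iteratedFDeriv_diag_le {N : ℝ} (hbd : ∀ m ≤ D, ∀ i : Fin m → Fin p, ∀ θ ∈ V,
    |partialDeriv i f θ| ≤ N) {m : ℕ} (hm : m ≤ D) {θ : Vec p} (hθ : θ ∈ V) (v : Vec p) :
    |iteratedFDeriv ℝ m f θ (fun _ => v)| ≤ (p : ℝ) ^ m * N * ‖v‖ ^ m :=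
  abs_multilinear_diag_le _ (fun i => hbd m hm i θ hθ) v

lemma abs_sub_taylor_line_le (hV : IsOpen V) (hVc : Convex ℝ V) (hD : DiffTimesOn D f V) {N : ℝ}
    (hbd : ∀ m ≤ D, ∀ i : Fin m → Fin p, ∀ θ ∈ V, |partialDeriv i f θ| ≤ N) {J : ℕ} (hJ : J ≤ D)
    {x v : Vec p} (hx : x ∈ V) (hxv : x + v ∈ V) :
    |f (x + v) - ∑ i ∈ range J, iteratedFDeriv ℝ i f x (fun _ => v) / (i ! : ℝ)| ≤
      (p : ℝ) ^ J * N * ‖v‖ ^ J := by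
  have h := abs_sub_taylor_le J
    (fun m t => iteratedFDeriv ℝ m f (x + t • v) (fun _ => v)) ((p : ℝ) ^ J * N * ‖v‖ ^ J)
    (fun m hm t ht => hasDerivAt_iteratedFDeriv_line hV hD (by omega) (line_mem hVc hx hxv ht))
    (fun t ht => abs_iteratedFDeriv_diag_le hbd hJ (line_mem hVc hx hxv ht) v)
  simpa using h

/-- Applied to the log-posterior at the mode, this gives a Gaussian upper bound on the whole ball,
where the local expansion is no longer informative. -/
lemma le_of_iteratedFDeriv_two_le (hV : IsOpen V) (hVc : Convex ℝ V) (hD : DiffTimesOn D f V)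
    (hD2 : 2 ≤ D) {a : ℝ} {x v : Vec p} (hx : x ∈ V) (hxv : x + v ∈ V)
    (hcrit : iteratedFDeriv ℝ 1 f x (fun _ => v) = 0)
    (ha : ∀ θ ∈ V, iteratedFDeriv ℝ 2 f θ (fun _ => v) ≤ a) :
    f (x + v) ≤ f x + a / 2 := by
  have h := le_taylor_of_le 2 (fun m t => iteratedFDeriv ℝ m f (x + t • v) (fun _ => v)) a
    (fun m hm t ht => hasDerivAt_iteratedFDeriv_line hV hD (by omega) (line_mem hVc hx hxv ht))
    (fun t ht => ha _ (line_mem hVc hx hxv ht)) 1 (Set.right_mem_Icc.2 zero_le_one)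
  simpa [Finset.sum_range_succ, hcrit, -iteratedFDeriv_one_apply] using h

/-- The derivative of order `D` may be discontinuous, so one order is lost; symmetry of the Hessian
through `C²` therefore needs `3 ≤ D`. -/
lemma DiffTimesOn.contDiffAt (hV : IsOpen V) (hD : DiffTimesOn D f V) {m : ℕ} (hm : m < D)
    {x : Vec p} (hx : x ∈ V) : ContDiffAt ℝ m f x := by
  refine (contDiffOn_of_differentiableOn (n := (m : ℕ∞)) (s := V) fun l hl => ?_).contDiffAt
    (hV.mem_nhds hx)
  have hl' : l ≤ m := by exact_mod_cast hl
  exact (hD l (by omega)).congr fun y hy => iteratedFDerivWithin_of_isOpen l hV hy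

lemma iteratedFDeriv_one_eq_zero_of_isMaxOn (hV : IsOpen V) {x : Vec p} (hx : x ∈ V)
    (hmax : ∀ θ ∈ V, f θ ≤ f x) (v : Vec p) : iteratedFDeriv ℝ 1 f x (fun _ => v) = 0 := by
  have h : IsLocalMax f x := Filter.mem_of_superset (hV.mem_nhds hx) hmax
  rw [iteratedFDeriv_one_apply, h.fderiv_eq_zero]
  rfl

/-- The matrix of negative second partial derivatives. -/
def negHess (f : Vec p → ℝ) (θ : Vec p) : Matrix (Fin p) (Fin p) ℝ :=
  Matrix.of fun i j => - partialDeriv ![i, j] f θ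

lemma partialDeriv_two (i j : Fin p) (x : Vec p) :
    partialDeriv ![i, j] f x = fderiv ℝ (fderiv ℝ f) x (e i) (e j) := by
  rw [partialDeriv, iteratedFDeriv_two_apply]
  rfl

lemma isHermitian_negHess (hV : IsOpen V) (hD : DiffTimesOn D f V) (hD3 : 3 ≤ D)
    {x : Vec p} (hx : x ∈ V) : (negHess f x).IsHermitian := by
  have h := (hD.contDiffAt hV (m := 2) (by omega) hx).isSymmSndFDerivAt (by simp)
  ext i j
  simp only [negHess, Matrix.conjTranspose_apply, Matrix.of_apply, star_trivial, partialDeriv_two]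
  rw [h (e i) (e j)]

lemma iteratedFDeriv_two_diag (x v : Vec p) :
    iteratedFDeriv ℝ 2 f x (fun _ => v) = -(v.ofLp ⬝ᵥ (negHess f x).mulVec v.ofLp) := by
  rw [iteratedFDeriv_two_apply]
  conv_lhs => rw [← sum_smul_e v]
  simp only [map_sum, map_smul, FunLike.coe_sum, Finset.sum_apply,
    smul_apply, smul_eq_mul, dotProduct, Matrix.mulVec, negHess,
    Matrix.of_apply, partialDeriv_two, Finset.mul_sum, ← Finset.sum_neg_distrib]
  rw [Finset.sum_comm]
  refine Finset.sum_congr rfl fun i _ => Finset.sum_congr rfl fun j _ => ?_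
  ring

/-- The rescaled terms of the Taylor expansion are graded polynomials. -/
lemma isGraded_taylor_term {M N ε κ B : ℝ} (hε : 0 < ε) (hN : N * ε ^ 2 = 1) (hM : 0 ≤ M)
    (hκ : 0 ≤ κ)
    (hbd : ∀ m ≤ D, ∀ i : Fin m → Fin p, ∀ θ ∈ V, |partialDeriv i f θ| ≤ N * M)
    (A : Vec p →L[ℝ] Vec p) (hA : ∀ z, ‖A z‖ ≤ ε * κ * ‖z‖) {x : Vec p} (hx : x ∈ V) {j K : ℕ}
    (hj : j + 3 ≤ D) (hjK : j + 3 ≤ K) (hB : (p : ℝ) ^ (j + 3) * M * κ ^ (j + 3) ≤ B) :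
    IsGraded (j + 1) B K fun z =>
      ε ^ 2 / ((j + 3)! : ℝ) * iteratedFDeriv ℝ (j + 3) f x (fun _ => ε⁻¹ • A z) where
  poly := by
    obtain ⟨q, hq, hfq⟩ := exists_polynomial_multilinear_diag
      ((iteratedFDeriv ℝ (j + 3) f x).compContinuousLinearMap fun _ => ε⁻¹ • A)
    refine ⟨MvPolynomial.C (ε ^ 2 / ((j + 3)! : ℝ)) * q, ?_, fun z => ?_⟩
    · refine (MvPolynomial.totalDegree_mul _ _).trans ?_
      rw [MvPolynomial.totalDegree_C]
      omega
    · rw [map_mul, MvPolynomial.eval_C, ← hfq]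
      rfl
  parity z := by
    have h := (iteratedFDeriv ℝ (j + 3) f x).map_smul_univ (fun _ => (-1 : ℝ)) (fun _ => ε⁻¹ • A z)
    simp only [Finset.prod_const, Finset.card_univ, Fintype.card_fin, smul_eq_mul, neg_smul,
      one_smul] at h
    simp only [map_neg, smul_neg, h]
    ring
  bound z := by
    have hN0 : 0 ≤ N := by
      by_contra hneg
      have : N * ε ^ 2 ≤ 0 := mul_nonpos_of_nonpos_of_nonneg (not_le.1 hneg).le (by positivity)
      linarith
    have hz : ‖ε⁻¹ • A z‖ ≤ κ * ‖z‖ := by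
      rw [norm_smul, Real.norm_of_nonneg (by positivity)]
      calc ε⁻¹ * ‖A z‖ ≤ ε⁻¹ * (ε * κ * ‖z‖) := by gcongr; exact hA z
        _ = κ * ‖z‖ := by field_simp
    have hd := abs_iteratedFDeriv_diag_le hbd hj hx (ε⁻¹ • A z)
    rw [abs_mul, abs_of_nonneg (by positivity)]
    calc _ ≤ ε ^ 2 * ((p : ℝ) ^ (j + 3) * (N * M) * ‖ε⁻¹ • A z‖ ^ (j + 3)) := by
          gcongr
          exact div_le_self (by positivity)
            (by exact_mod_cast Nat.one_le_iff_ne_zero.2 (Nat.factorial_ne_zero _))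
      _ ≤ ε ^ 2 * ((p : ℝ) ^ (j + 3) * (N * M) * (κ * ‖z‖) ^ (j + 3)) := by gcongr
      _ = (N * ε ^ 2) * ((p : ℝ) ^ (j + 3) * M * κ ^ (j + 3)) * ‖z‖ ^ (j + 3) := by
          rw [mul_pow]; ring
      _ ≤ 1 * B * (1 + ‖z‖) ^ K := by
          rw [hN]
          have h1 : ‖z‖ ^ (j + 3) ≤ (1 + ‖z‖) ^ (j + 3) := by gcongr; linarith
          have h2 : (1 + ‖z‖) ^ (j + 3) ≤ (1 + ‖z‖) ^ K :=
            pow_le_pow_right₀ (by linarith [norm_nonneg z]) hjK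
          have : 0 ≤ B := le_trans (by positivity) hB
          gcongr
          exact h1.trans h2
      _ = _ := by ring

/-- The remainder of the second order Taylor expansion at a critical point, along a linear
map that normalizes the second derivative, is a graded polynomial in `ε` up to `ε ^ (n + 1)`. -/
lemma abs_remainder_sub_taylor_le {M N ε κ B : ℝ} (hV : IsOpen V) (hVc : Convex ℝ V)
    (hD : DiffTimesOn D f V) (hε : 0 < ε) (hN : N * ε ^ 2 = 1) (hM : 0 ≤ M) (hκ : 0 ≤ κ)
    (hbd : ∀ m ≤ D, ∀ i : Fin m → Fin p, ∀ θ ∈ V, |partialDeriv i f θ| ≤ N * M)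
    (A : Vec p →L[ℝ] Vec p) (hA : ∀ z, ‖A z‖ ≤ ε * κ * ‖z‖) {x : Vec p} (hx : x ∈ V)
    (hcrit : ∀ v, iteratedFDeriv ℝ 1 f x (fun _ => v) = 0)
    (hnorm : ∀ z, iteratedFDeriv ℝ 2 f x (fun _ => A z) = -‖z‖ ^ 2) {n K : ℕ}
    (hn : n + 3 ≤ D) (hnK : n + 3 ≤ K) (hB : (p : ℝ) ^ (n + 3) * M * κ ^ (n + 3) ≤ B)
    {z : Vec p} (hz : A z + x ∈ V) :
    |(f (A z + x) - f x + ‖z‖ ^ 2 / 2) - ∑ j : Fin n, ε ^ ((j : ℕ) + 1) *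
      (ε ^ 2 / (((j : ℕ) + 3)! : ℝ) * iteratedFDeriv ℝ (j + 3) f x (fun _ => ε⁻¹ • A z))| ≤
      B * ε ^ (n + 1) * (1 + ‖z‖) ^ K := by
  have hN0 : 0 ≤ N := by
    by_contra hneg
    have : N * ε ^ 2 ≤ 0 := mul_nonpos_of_nonpos_of_nonneg (not_le.1 hneg).le (by positivity)
    linarith
  rw [add_comm] at hz
  have h := abs_sub_taylor_line_le hV hVc hD hbd hn hx hz
  have hterm : ∀ j : ℕ, iteratedFDeriv ℝ (j + 3) f x (fun _ => A z) / ((j + 3)! : ℝ) =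
      ε ^ (j + 1) * (ε ^ 2 / ((j + 3)! : ℝ) *
        iteratedFDeriv ℝ (j + 3) f x (fun _ => ε⁻¹ • A z)) := by
    intro j
    have h := (iteratedFDeriv ℝ (j + 3) f x).map_smul_univ (fun _ => ε) (fun _ => ε⁻¹ • A z)
    simp only [Finset.prod_const, Finset.card_univ, Fintype.card_fin, smul_eq_mul,
      smul_inv_smul₀ hε.ne'] at h
    rw [h]
    ring
  -- Peels off the orders zero, one and two: the value, the vanishing gradient and the normalized
  -- quadratic form.
  rw [Finset.sum_range_succ', Finset.sum_range_succ', Finset.sum_range_succ'] at h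
  simp only [add_assoc, Nat.reduceAdd, zero_add, hterm, hcrit, hnorm] at h
  rw [Finset.sum_range] at h
  have heq : (f (A z + x) - f x + ‖z‖ ^ 2 / 2) - ∑ j : Fin n, ε ^ ((j : ℕ) + 1) *
      (ε ^ 2 / (((j : ℕ) + 3)! : ℝ) * iteratedFDeriv ℝ (j + 3) f x (fun _ => ε⁻¹ • A z)) =
      f (x + A z) - (∑ j : Fin n, ε ^ ((j : ℕ) + 1) *
      (ε ^ 2 / (((j : ℕ) + 3)! : ℝ) * iteratedFDeriv ℝ (j + 3) f x (fun _ => ε⁻¹ • A z)) +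
      (-‖z‖ ^ 2 / (2 ! : ℝ) + (0 / (1 ! : ℝ) +
        iteratedFDeriv ℝ 0 f x (fun _ => A z) / (0 ! : ℝ)))) := by
    simp [add_comm x]
    ring
  rw [heq]
  refine h.trans ?_
  calc _ ≤ (p : ℝ) ^ (n + 3) * (N * M) * (ε * κ * ‖z‖) ^ (n + 3) := by gcongr; exact hA z
    _ = (N * ε ^ 2) * ((p : ℝ) ^ (n + 3) * M * κ ^ (n + 3)) * ε ^ (n + 1) * ‖z‖ ^ (n + 3) := by
        rw [mul_pow, mul_pow]; ring
    _ ≤ 1 * B * ε ^ (n + 1) * (1 + ‖z‖) ^ K := by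
        rw [hN]
        have h1 : ‖z‖ ^ (n + 3) ≤ (1 + ‖z‖) ^ (n + 3) := by gcongr; linarith
        have h2 : (1 + ‖z‖) ^ (n + 3) ≤ (1 + ‖z‖) ^ K :=
          pow_le_pow_right₀ (by linarith [norm_nonneg z]) hnK
        have : 0 ≤ B := le_trans (by positivity) hB
        gcongr
        exact h1.trans h2
    _ = _ := by ring

end Line

/-! ### Events of probability tending to one -/

namespace WithProbTendingToOne

variable {d : ℕ} {P : ∀ n : ℕ, Measure (Dataset n d)} {A B : ∀ n : ℕ, Dataset n d → Prop}

lemma mono (hA : WithProbTendingToOne P A) (h : ∀ᶠ n in atTop, ∀ y, A n y → B n y) :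
    WithProbTendingToOne P B := by
  refine tendsto_of_tendsto_of_tendsto_of_le_of_le' tendsto_const_nhds hA
    (Eventually.of_forall fun n => zero_le) ?_
  filter_upwards [h] with n hn
  exact measure_mono fun y hy hAy => hy (hn y hAy)

lemma and (hA : WithProbTendingToOne P A) (hB : WithProbTendingToOne P B) :
    WithProbTendingToOne P fun n y => A n y ∧ B n y := by
  have h := Tendsto.add hA hB
  rw [add_zero] at h
  refine tendsto_of_tendsto_of_tendsto_of_le_of_le tendsto_const_nhds h (fun n => zero_le)
    fun n => le_trans (measure_mono fun y hy => ?_) (measure_union_le _ _)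
  by_cases h : A n y
  · exact Or.inr fun hB => hy ⟨h, hB⟩
  · exact Or.inl h

/-- Turns one event per multi-index into a single event for all derivative bounds. -/
lemma forall_fintype {ι : Type*} [Fintype ι] {A : ι → ∀ n : ℕ, Dataset n d → Prop}
    (hA : ∀ i, WithProbTendingToOne P (A i)) :
    WithProbTendingToOne P fun n y => ∀ i, A i n y := by
  have h := tendsto_finsetSum Finset.univ fun i _ => hA i
  rw [Finset.sum_const_zero] at h
  refine tendsto_of_tendsto_of_tendsto_of_le_of_le tendsto_const_nhds h (fun n => zero_le)
    fun n => le_trans (measure_mono fun y hy => ?_) (measure_iUnion_fintype_le _ _)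
  simpa using hy

end WithProbTendingToOne

/-- Only consistency is needed: the choice `G n = √n` cancels the rate. -/
lemma RootNConsistent.withProbTendingToOne {p d : ℕ} {P : ∀ n : ℕ, Measure (Dataset n d)}
    {mode : ∀ n : ℕ, Dataset n d → Vec p} {θs : Vec p} (h : RootNConsistent P mode θs) {β : ℝ}
    (hβ : 0 < β) : WithProbTendingToOne P fun n y => ‖mode n y - θs‖ ≤ β := by
  have h1 : WithProbTendingToOne P fun n y =>
      ¬ β < Real.sqrt n / Real.sqrt n * ‖mode n y - θs‖ := by
    have := h β hβ (fun n => Real.sqrt n)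
      (Real.tendsto_sqrt_atTop.comp tendsto_natCast_atTop_atTop)
    simpa only [WithProbTendingToOne, not_not] using this
  refine h1.mono ?_
  filter_upwards [eventually_gt_atTop 0] with n hn y hy
  have : Real.sqrt n ≠ 0 := (Real.sqrt_pos.2 (by exact_mod_cast hn)).ne'
  rw [div_self this, one_mul] at hy
  exact not_lt.1 hy

/-! ### The posterior away from the mode -/

lemma Model.lik_le_of_logLik_sub_le {p d : ℕ} (𝓜 : Model p d) {n : ℕ} {y : Dataset n d}
    {θ θs : Vec p} {c : ℝ} (hθs : 0 < 𝓜.lik n y θs)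
    (h : 𝓜.logLik n y θ - 𝓜.logLik n y θs ≤ (c : EReal)) :
    𝓜.lik n y θ ≤ Real.exp c * 𝓜.lik n y θs := by
  rcases le_or_gt (𝓜.lik n y θ) 0 with h0 | h0
  · exact h0.trans (by positivity)
  · simp only [Model.logLik, ENNReal.log_ofReal, if_neg (not_le.2 h0), if_neg (not_le.2 hθs)] at h
    rw [← EReal.coe_sub, EReal.coe_le_coe_iff] at h
    rw [← Real.exp_log h0]
    calc Real.exp (Real.log (𝓜.lik n y θ)) ≤ Real.exp (c + Real.log (𝓜.lik n y θs)) :=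
          Real.exp_le_exp.2 (by linarith)
      _ = _ := by rw [Real.exp_add, Real.exp_log hθs]

lemma nat_pow_mul_exp_neg_le {b : ℝ} (hb : 0 < b) (n j : ℕ) :
    (n : ℝ) ^ j * Real.exp (-(n * b)) ≤ Real.exp ((2 * j : ℕ) ^ 2 / (2 * b)) := by
  have hw : 0 ≤ Real.sqrt n := Real.sqrt_nonneg _
  have h := one_add_pow_mul_exp_le hb (2 * j) (Real.sqrt n) hw
  have hsq : Real.sqrt n ^ 2 = n := Real.sq_sqrt (by positivity)
  calc (n : ℝ) ^ j * Real.exp (-(n * b))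
      = Real.sqrt n ^ (2 * j) * Real.exp (-(b * Real.sqrt n ^ 2)) := by
        rw [pow_mul, hsq, mul_comm b]
    _ ≤ (1 + Real.sqrt n) ^ (2 * j) * Real.exp (-(b * Real.sqrt n ^ 2)) := by gcongr; linarith
    _ ≤ _ := h
    _ ≤ Real.exp ((2 * j : ℕ) ^ 2 / (2 * b)) * 1 := by
        gcongr
        exact Real.exp_le_one_iff.2 (by rw [neg_nonpos]; positivity)
    _ = _ := mul_one _

section Outer

variable {p d : ℕ} (𝓜 : Model p d) {n : ℕ} {y : Dataset n d} {m θs : Vec p} {δ b c₁ : ℝ}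

/-- The posterior mass outside the ball is exponentially small, relative to the maximum of the
posterior density. -/
lemma Model.integral_post_diff_ball (hδ : 0 < δ) (hball : Metric.ball θs δ ⊆ 𝓜.Θ)
    (hc₁ : 0 < c₁) (hprior : ∀ θ ∈ Metric.ball θs δ, c₁ ≤ 𝓜.prior θ)
    (hmode : 𝓜.IsPosteriorMode n y m) (hpos : ∀ θ ∈ Metric.ball θs δ, 0 < 𝓜.post n y θ)
    (hsep : ∀ θ ∈ 𝓜.Θ \ Metric.ball θs δ,
      𝓜.logLik n y θ - 𝓜.logLik n y θs ≤ ((-(n * b) : ℝ) : EReal)) :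
    ∃ a : ℝ, 𝓜.marginal n y = (∫ θ in Metric.ball θs δ, 𝓜.post n y θ) + a * 𝓜.post n y m ∧
      0 ≤ a ∧ a ≤ Real.exp (-(n * b)) / c₁ := by
  have hθs : θs ∈ Metric.ball θs δ := Metric.mem_ball_self hδ
  have hpriors := hprior θs hθs
  have hprior0 : 0 < 𝓜.prior θs := hc₁.trans_le hpriors
  have hlik : 0 < 𝓜.lik n y θs := (pos_iff_pos_of_mul_pos (hpos θs hθs)).1 hprior0
  have hpm : 0 < 𝓜.post n y m := (hpos θs hθs).trans_le (hmode.2 θs (hball hθs))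
  -- The separation compares likelihoods at `θs`; the lower bound of the prior there turns this into
  -- a comparison with the maximum of the posterior.
  have hlik' : 𝓜.lik n y θs ≤ 𝓜.post n y m / c₁ := by
    rw [le_div_iff₀ hc₁]
    calc 𝓜.lik n y θs * c₁ ≤ 𝓜.lik n y θs * 𝓜.prior θs := by gcongr
      _ = 𝓜.post n y θs := mul_comm _ _
      _ ≤ _ := hmode.2 θs (hball hθs)
  set V := 𝓜.Θ \ Metric.ball θs δ with hV
  have hVm : MeasurableSet V := 𝓜.measurableSet_Θ.diff measurableSet_ball
  have hmeas : AEStronglyMeasurable (𝓜.post n y) (volume.restrict 𝓜.Θ) :=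
    (𝓜.integrable_prior.aestronglyMeasurable.aemeasurable.mul
      (𝓜.aemeasurable_lik n y)).aestronglyMeasurable
  set a₀ : ℝ := Real.exp (-(n * b)) * (𝓜.post n y m / c₁) with ha₀
  have ha₀0 : 0 ≤ a₀ := by positivity
  have hpost0 : ∀ θ ∈ 𝓜.Θ, 0 ≤ 𝓜.post n y θ := fun θ hθ =>
    mul_nonneg (𝓜.prior_nonneg θ hθ) (𝓜.lik_nonneg n y θ hθ)
  have hle : ∀ θ ∈ V, 𝓜.post n y θ ≤ a₀ * 𝓜.prior θ := fun θ hθ => by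
    have h1 := 𝓜.lik_le_of_logLik_sub_le hlik (hsep θ hθ)
    have h2 := 𝓜.prior_nonneg θ hθ.1
    calc 𝓜.post n y θ = 𝓜.lik n y θ * 𝓜.prior θ := mul_comm _ _
      _ ≤ (Real.exp (-(n * b)) * 𝓜.lik n y θs) * 𝓜.prior θ := by gcongr
      _ ≤ a₀ * 𝓜.prior θ := by rw [ha₀]; gcongr
  have hpriorV : IntegrableOn 𝓜.prior V := 𝓜.integrable_prior.mono_set Set.sdiff_subset
  have hint1 : IntegrableOn (𝓜.post n y) V := by
    refine (hpriorV.const_mul a₀).mono' (hmeas.mono_set Set.sdiff_subset) ?_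
    filter_upwards [ae_restrict_mem hVm] with θ hθ
    rw [Real.norm_of_nonneg (hpost0 θ hθ.1)]
    exact hle θ hθ
  have hint2 : IntegrableOn (𝓜.post n y) (Metric.ball θs δ) := by
    refine (integrableOn_const (C := 𝓜.post n y m) measure_ball_lt_top.ne).mono'
      (hmeas.mono_set hball) ?_
    filter_upwards [ae_restrict_mem measurableSet_ball] with θ hθ
    rw [Real.norm_of_nonneg (hpos θ hθ).le]
    exact hmode.2 θ (hball hθ)
  have hsplit : 𝓜.marginal n y =
      (∫ θ in Metric.ball θs δ, 𝓜.post n y θ) + ∫ θ in V, 𝓜.post n y θ := by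
    rw [Model.marginal, ← setIntegral_union Set.disjoint_sdiff_right hVm hint2 hint1,
      Set.union_sdiff_cancel hball]
  refine ⟨(∫ θ in V, 𝓜.post n y θ) / 𝓜.post n y m, ?_, ?_, ?_⟩
  · rw [div_mul_cancel₀ _ hpm.ne', hsplit]
  · exact div_nonneg (setIntegral_nonneg hVm fun θ hθ => hpost0 θ hθ.1) hpm.le
  · rw [div_le_iff₀ hpm]
    calc ∫ θ in V, 𝓜.post n y θ ≤ ∫ θ in V, a₀ * 𝓜.prior θ :=
          setIntegral_mono_on hint1 (hpriorV.const_mul a₀) hVm hle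
      _ = a₀ * ∫ θ in V, 𝓜.prior θ := integral_const_mul _ _
      _ ≤ a₀ * ∫ θ in 𝓜.Θ, 𝓜.prior θ := by
          refine mul_le_mul_of_nonneg_left ?_ ha₀0
          refine setIntegral_mono_set 𝓜.integrable_prior ?_ Set.sdiff_subset.eventuallyLE
          filter_upwards [ae_restrict_mem 𝓜.measurableSet_Θ] with θ hθ
          exact 𝓜.prior_nonneg θ hθ
      _ = _ := by rw [𝓜.integral_prior, ha₀]; ring

end Outer

/-! ### The deterministic estimate -/

/-- On data that satisfy the regularity conditions, the relative error of adaptive quadrature is of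
order `n ^ (-r)`. -/
theorem Model.exists_abs_marginal_div_adaptive_sub_one_le {p d : ℕ} (𝓜 : Model p d)
    (R : QuadRule p) {D k r : ℕ} (hk : 1 ≤ k) (hr1 : 1 ≤ r) (hr : 3 * r ≤ k + 2)
    (hrD : 2 * r + 2 ≤ D) (hsymm : R.IsSymmetric) (hexact : R.IsExact k)
    {δ M η₁ η₂ b c₁ : ℝ} {θs : Vec p} (hδ : 0 < δ) (hball : Metric.ball θs δ ⊆ 𝓜.Θ) (hM : 0 < M)
    (hη₁ : 0 < η₁) (hη : η₁ ≤ η₂) (hb : 0 < b) (hc₁ : 0 < c₁)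
    (hprior : ∀ θ ∈ Metric.ball θs δ, c₁ ≤ 𝓜.prior θ) :
    ∃ C > (0 : ℝ), ∀ᶠ n : ℕ in atTop, ∀ (y : Dataset n d) (m : Vec p),
      𝓜.IsPosteriorMode n y m → ‖m - θs‖ ≤ δ / 2 →
      (∀ θ ∈ Metric.ball θs δ, 0 < 𝓜.post n y θ) →
      DiffTimesOn D (𝓜.logPost n y) (Metric.ball θs δ) →
      (∀ l ≤ D, ∀ i : Fin l → Fin p, ∀ θ ∈ Metric.ball θs δ,
        |partialDeriv i (𝓜.logPost n y) θ| ≤ n * M) →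
      (∀ θ ∈ Metric.ball θs δ, ∀ μ ∈ spectrum ℝ (𝓜.negHessian n y θ),
        n * η₁ ≤ μ ∧ μ ≤ n * η₂) →
      (∀ θ ∈ 𝓜.Θ \ Metric.ball θs δ,
        𝓜.logLik n y θ - 𝓜.logLik n y θs ≤ ((-(n * b) : ℝ) : EReal)) →
      |𝓜.marginal n y / R.adaptive 𝓜 n y m - 1| ≤ C / (n : ℝ) ^ r := by
  have hη₂ : 0 < η₂ := hη₁.trans_le hη
  set κ : ℝ := (Real.sqrt η₁)⁻¹ with hκ
  have hκpos : 0 < κ := by positivity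
  have hκη : κ ^ 2 * η₁ = 1 := by
    rw [hκ, inv_pow, Real.sq_sqrt hη₁.le, inv_mul_cancel₀ hη₁.ne']
  -- One constant for all Taylor orders up to `2 r + 2`; the summand `1` secures `1 ≤ B`.
  set B : ℝ := 1 + ∑ l ∈ range (2 * r + 3), (p : ℝ) ^ l * M * κ ^ l with hB
  have hBl : ∀ l ≤ 2 * r + 2, (p : ℝ) ^ l * M * κ ^ l ≤ B := by
    intro l hl
    have := Finset.single_le_sum (f := fun l => (p : ℝ) ^ l * M * κ ^ l) (s := range (2 * r + 3))
      (fun l _ => by positivity) (Finset.mem_range.2 (show l < 2 * r + 3 by omega))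
    linarith
  have hB1 : 1 ≤ B := le_add_of_nonneg_right (Finset.sum_nonneg fun l _ => by positivity)
  clear_value B
  have hc : 0 < η₁ / (2 * η₂) := by positivity
  have hc2 : η₁ / (2 * η₂) ≤ 1 / 2 := by rw [div_le_div_iff₀ (by positivity) two_pos]; linarith
  -- There are `2 r - 1` correction terms, of orders `3` to `2 r + 1`, with the remainder at order
  -- `2 r + 2 ≤ D`. The radius `δ / (2 κ)` makes `‖L z‖ < δ / 2`, and the mode lies within `δ / 2`
  -- of the centre.
  obtain ⟨C, hC, γ, hγ, ε₀, hε₀, hcore⟩ := R.exists_abs_integral_sub_sum_le hk hr1 hr hsymm hexact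
    (2 * r - 1) (2 * r + 2) hB1 hc hc2 (ρ := δ / (2 * κ)) (by positivity)
  -- The suprema over `n` of `n ^ r * exp (-n b)` and `n ^ (r + p) * exp (-n b)`; the extra `n ^ p`
  -- comes from `(det L)⁻¹`.
  set E : ℝ := Real.exp ((2 * r : ℕ) ^ 2 / (2 * b)) +
    η₂ ^ p * Real.exp ((2 * (r + p) : ℕ) ^ 2 / (2 * b)) with hE
  refine ⟨(C + E / c₁) / γ, by positivity, ?_⟩
  have hev : ∀ᶠ n : ℕ in atTop, (Real.sqrt n)⁻¹ ≤ ε₀ := by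
    have : Tendsto (fun n : ℕ => (Real.sqrt n)⁻¹) atTop (𝓝 0) :=
      tendsto_inv_atTop_zero.comp (Real.tendsto_sqrt_atTop.comp tendsto_natCast_atTop_atTop)
    exact this.eventually_le_const hε₀
  filter_upwards [hev, eventually_gt_atTop 0] with n hn hn0 y m hmode hm hpos hD hbd hspec hsep
  have hn0' : (0 : ℝ) < n := by exact_mod_cast hn0
  set ε : ℝ := (Real.sqrt n)⁻¹ with hε
  have hεpos : 0 < ε := by positivity
  have hnε : (n : ℝ) * ε ^ 2 = 1 := by
    rw [hε, inv_pow, Real.sq_sqrt hn0'.le, mul_inv_cancel₀ hn0'.ne']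
  have hεr : ε ^ (2 * r) = 1 / (n : ℝ) ^ r := by
    rw [pow_mul, hε, inv_pow, Real.sq_sqrt hn0'.le, inv_pow, one_div]
  clear_value ε
  set f := 𝓜.logPost n y with hf
  set V := Metric.ball θs δ with hV
  have hVo : IsOpen V := Metric.isOpen_ball
  have hVc : Convex ℝ V := convex_ball _ _
  have hmV : m ∈ V := by
    rw [hV, mem_ball_iff_norm]; linarith
  have hpm : 0 < 𝓜.post n y m := hpos m hmV
  have hexpf : ∀ θ ∈ V, Real.exp (f θ) = 𝓜.post n y θ := fun θ hθ => Real.exp_log (hpos θ hθ)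
  have hfmax : ∀ θ ∈ V, f θ ≤ f m := fun θ hθ =>
    Real.log_le_log (hpos θ hθ) (hmode.2 θ (hball hθ))
  have hcrit := iteratedFDeriv_one_eq_zero_of_isMaxOn hVo hmV hfmax
  have hherm : ∀ θ ∈ V, (negHess f θ).IsHermitian := fun θ hθ =>
    isHermitian_negHess hVo hD (by omega) hθ
  have hspec' : ∀ θ ∈ V, ∀ μ ∈ spectrum ℝ (negHess f θ), n * η₁ ≤ μ ∧ μ ≤ n * η₂ := hspec
  set H := negHess f m with hH
  have hHm := hherm m hmV
  have hHpos : H.PosDef :=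
    posDef_of_spectrum hHm (by positivity) fun μ hμ => (hspec' m hmV μ hμ).1
  set L := cholesky H⁻¹ with hL
  have hchol : IsCholesky H⁻¹ L := isCholesky_cholesky hHpos.inv
  have hdet : 0 < L.det := hchol.det_pos
  have hdetinv : L.det⁻¹ ≤ 1 + (n * η₂) ^ p :=
    hchol.inv_det_le hHpos (a := n * η₁) (by positivity) (hspec' m hmV)
  clear_value L
  set A : Vec p →L[ℝ] Vec p := LinearMap.toContinuousLinearMap (Matrix.toLpLin 2 2 L) with hA
  have hAz : ∀ z, A z = WithLp.toLp 2 (L.mulVec z) := fun z => rfl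
  have hquad : ∀ z, (A z).ofLp ⬝ᵥ H.mulVec (A z).ofLp = ‖z‖ ^ 2 := fun z => by
    rw [← dotProduct_self_eq_norm_sq, ← hchol.dotProduct_mulVec_self hHpos]
    rfl
  clear_value A
  have hAlow : ∀ z, n * η₁ * ‖A z‖ ^ 2 ≤ ‖z‖ ^ 2 := fun z => by
    rw [← hquad z]
    exact mul_norm_sq_le_of_spectrum hHm (fun μ hμ => (hspec' m hmV μ hμ).1) _
  have hAup : ∀ z, ‖z‖ ^ 2 ≤ n * η₂ * ‖A z‖ ^ 2 := fun z => by
    rw [← hquad z]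
    exact le_mul_norm_sq_of_spectrum hHm (fun μ hμ => (hspec' m hmV μ hμ).2) _
  have hAnorm : ∀ z, ‖A z‖ ≤ ε * κ * ‖z‖ := fun z => by
    refine le_of_sq_le_sq ?_ (by positivity)
    calc ‖A z‖ ^ 2 = (n * ε ^ 2) * (κ ^ 2 * η₁) * ‖A z‖ ^ 2 := by rw [hnε, hκη]; ring
      _ = (ε * κ) ^ 2 * (n * η₁ * ‖A z‖ ^ 2) := by ring
      _ ≤ (ε * κ) ^ 2 * ‖z‖ ^ 2 := by gcongr; exact hAlow z
      _ = _ := by ring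
  have hnorm : ∀ z, iteratedFDeriv ℝ 2 f m (fun _ => A z) = -‖z‖ ^ 2 := fun z => by
    rw [iteratedFDeriv_two_diag, ← hH, hquad]
  set U : Set (Vec p) := {z | A z + m ∈ V} with hU
  set q : Vec p → ℝ := fun z => f (A z + m) - f m + ‖z‖ ^ 2 / 2 with hq
  have hfcont : ContinuousOn f V := fun θ hθ =>
    (hD.contDiffAt hVo (m := 0) (by omega) hθ).continuousAt.continuousWithinAt
  have hqcont : ContinuousOn q U := by
    have h1 : ContinuousOn (fun z => f (A z + m)) U :=
      hfcont.comp (by fun_prop) fun z hz => hz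
    exact (h1.sub continuousOn_const).add (by fun_prop)
  have hUm : MeasurableSet U :=
    (hVo.preimage (show Continuous fun z => A z + m by fun_prop)).measurableSet
  obtain ⟨hFint, hpts, hmain, hlow⟩ := hcore ε hεpos hn
    (fun j z => ε ^ 2 / (((j : ℕ) + 3)! : ℝ) *
      iteratedFDeriv ℝ ((j : ℕ) + 3) f m (fun _ => ε⁻¹ • A z)) U q
    (fun j => isGraded_taylor_term hεpos hnε hM.le hκpos.le hbd A hAnorm hmV
      (by have := j.2; omega) (by have := j.2; omega) (hBl _ (by have := j.2; omega)))
    hUm hqcont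
    (fun z hz => by
      rw [hU, Set.mem_ofPred_eq, hV, mem_ball_iff_norm]
      rw [lt_div_iff₀ (by positivity)] at hz
      have h1 := hAnorm z
      calc ‖A z + m - θs‖ = ‖A z + (m - θs)‖ := by rw [add_sub_assoc]
        _ ≤ ‖A z‖ + ‖m - θs‖ := norm_add_le _ _
        _ < δ := by linarith)
    -- With no correction terms, the third-order remainder bound says that `q` is of order `ε`.
    (fun z hz => by
      have h := abs_remainder_sub_taylor_le hVo hVc hD hεpos hnε hM.le hκpos.le hbd A hAnorm hmV
        hcrit hnorm (n := 0) (K := 2 * r + 2) (by omega) (by omega) (hBl 3 (by omega)) hz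
      simpa using h)
    (fun z hz => by
      have h := abs_remainder_sub_taylor_le hVo hVc hD hεpos hnε hM.le hκpos.le hbd A hAnorm hmV
        hcrit hnorm (n := 2 * r - 1) (K := 2 * r + 2) (by omega) (by omega) (hBl _ (by omega)) hz
      rwa [show 2 * r - 1 + 1 = 2 * r by omega] at h)
    -- The constant `η₁ / (2 η₂)`: concavity along the segment costs `n η₁ ‖A z‖² / 2`, while `‖z‖²
    -- ≤ n η₂ ‖A z‖²` by normalization at the mode.
    (fun z hz => by
      have hz' : m + A z ∈ V := by rw [add_comm]; exact hz
      have h := le_of_iteratedFDeriv_two_le hVo hVc hD (by omega) (a := -(n * η₁ * ‖A z‖ ^ 2))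
        hmV hz' (hcrit _) (fun θ hθ => by
          rw [iteratedFDeriv_two_diag, neg_le_neg_iff]
          exact mul_norm_sq_le_of_spectrum (hherm θ hθ) (fun μ hμ => (hspec' θ hθ μ hμ).1) _)
      have h2 : η₁ / (2 * η₂) * ‖z‖ ^ 2 ≤ n * η₁ * ‖A z‖ ^ 2 / 2 := by
        calc _ ≤ η₁ / (2 * η₂) * (n * η₂ * ‖A z‖ ^ 2) := by gcongr; exact hAup z
          _ = _ := by field_simp
      simp only [hq]
      rw [add_comm m] at h
      linarith)
  have hF : ∀ z ∈ U, 𝓜.post n y (A z + m) =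
      𝓜.post n y m * Real.exp (-(‖z‖ ^ 2 / 2) + q z) := fun z hz => by
    rw [← hexpf _ hz, ← hexpf m hmV, ← Real.exp_add]
    congr 1
    simp only [hq]
    ring
  set S : ℝ := ∑ z ∈ R.points, Real.exp (-(‖z‖ ^ 2 / 2) + q z) * R.weight z with hS
  set I : ℝ := ∫ z in U, Real.exp (-(‖z‖ ^ 2 / 2) + q z) with hI
  have hadapt : R.adaptive 𝓜 n y m = L.det * (𝓜.post n y m * S) := by
    have h1 : R.adaptive 𝓜 n y m =
        L.det * ∑ z ∈ R.points, 𝓜.post n y (A z + m) * R.weight z := by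
      simp only [hAz, hL]; rfl
    rw [h1, hS, Finset.mul_sum _ _ (𝓜.post n y m)]
    congr 1
    refine Finset.sum_congr rfl fun z hz => ?_
    rw [hF z (hpts z hz)]
    ring
  have hinner : ∫ θ in V, 𝓜.post n y θ = L.det * (𝓜.post n y m * I) := by
    rw [setIntegral_affine hdet m measurableSet_ball, hI, ← integral_const_mul (𝓜.post n y m)]
    simp only [← hAz]
    congr 1
    exact setIntegral_congr_fun hUm fun z hz => hF z hz
  obtain ⟨a, hmarg, ha0, ha⟩ :=
    𝓜.integral_post_diff_ball hδ hball hc₁ hprior hmode hpos hsep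
  have hSpos : 0 < S := hγ.trans_le hlow
  -- The factors `det L` and `post m` cancel, except that `(det L)⁻¹` survives on the mass outside
  -- the ball.
  have hratio : 𝓜.marginal n y / R.adaptive 𝓜 n y m - 1 = ((I - S) + a * L.det⁻¹) / S := by
    rw [hadapt, hmarg, hinner]
    field_simp
    ring
  have hexpo : Real.exp (-(n * b)) * (1 + (n * η₂) ^ p) ≤ E / (n : ℝ) ^ r := by
    rw [le_div_iff₀ (by positivity)]
    have h1 := nat_pow_mul_exp_neg_le hb n r
    have h2 := nat_pow_mul_exp_neg_le hb n (r + p)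
    calc _ = (n : ℝ) ^ r * Real.exp (-(n * b)) +
          η₂ ^ p * ((n : ℝ) ^ (r + p) * Real.exp (-(n * b))) := by rw [mul_pow, pow_add]; ring
      _ ≤ E := by rw [hE]; gcongr
  have houter : a * L.det⁻¹ ≤ E / c₁ / (n : ℝ) ^ r := by
    calc a * L.det⁻¹ ≤ Real.exp (-(n * b)) / c₁ * (1 + (n * η₂) ^ p) := by gcongr
      _ = Real.exp (-(n * b)) * (1 + (n * η₂) ^ p) / c₁ := by ring
      _ ≤ E / (n : ℝ) ^ r / c₁ := by gcongr
      _ = _ := by ring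
  rw [hratio, abs_div, abs_of_pos hSpos]
  have ha0' : 0 ≤ a * L.det⁻¹ := by positivity
  calc |(I - S) + a * L.det⁻¹| / S ≤ (C / (n : ℝ) ^ r + E / c₁ / (n : ℝ) ^ r) / γ := by
        gcongr
        refine (abs_add_le _ _).trans (add_le_add ?_ ?_)
        · rw [hεr] at hmain
          exact hmain.trans_eq (by ring)
        · rwa [abs_of_nonneg ha0']
    _ = _ := by ring

end AdaptiveQuadrature

end

/-! ### From the deterministic estimate to probability -/

open AdaptiveQuadrature in
theorem theorem1 {p d : ℕ} (hp : 1 ≤ p)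
    (𝓜 : Model p d)
    (P : ∀ n : ℕ, Measure (Dataset n d)) [∀ n, IsProbabilityMeasure (P n)]
    (mode : ∀ n : ℕ, Dataset n d → Vec p)
    (hmode : WithProbTendingToOne P fun n y => 𝓜.IsPosteriorMode n y (mode n y))
    (D : ℕ) (hD : 4 ≤ D)
    (hdiff : ∀ n y, DiffTimesOn D (𝓜.lik n y) (interior 𝓜.Θ))
    (hreg : 𝓜.Regular P mode D)
    (k : ℕ) (hk₁ : 1 ≤ k) (hk₂ : k ≤ D / 2)
    (R : QuadRule p) (hsymm : R.IsSymmetric) (hexact : R.IsExact k) :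
    ∃ C > (0 : ℝ), WithProbTendingToOne P fun n y =>
      |𝓜.marginal n y / R.adaptive 𝓜 n y (mode n y) - 1| ≤ C / (n : ℝ) ^ ((k + 2) / 3) := by
  obtain ⟨δ, hδ, θs, hball, ⟨M, hM, hfin, hderiv⟩, ⟨η₁, η₂, hη₁, hη, hspec⟩, ⟨b, hb, hsep⟩, hroot,
    ⟨c₁, c₂, hc₁, -, hprior⟩⟩ := hreg
  obtain ⟨C, hC, hev⟩ := 𝓜.exists_abs_marginal_div_adaptive_sub_one_le R (D := D) (k := k)
    (r := (k + 2) / 3) hk₁ (by omega) (by omega) (by omega) hsymm hexact hδ hball hM hη₁ hη hb hc₁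
    fun θ hθ => (hprior θ hθ).1
  refine ⟨C, hC, ?_⟩
  -- The derivative orders and multi-indices form a finite type, so the separate events can be
  -- intersected.
  have hbd := WithProbTendingToOne.forall_fintype
    fun i : Σ l : Fin (D + 1), (Fin l → Fin p) => hderiv i.1 (Nat.lt_succ_iff.1 i.1.2) i.2
  refine (((((hmode.and (hroot.withProbTendingToOne (half_pos hδ))).and hfin).and hbd).and
    hspec).and hsep).mono ?_
  filter_upwards [hev] with n hn y hy
  obtain ⟨⟨⟨⟨⟨h1, h2⟩, h3, h4⟩, h5⟩, h6⟩, h7⟩ := hy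
  exact hn y _ h1 h2 h3 h4 (fun l hl i => h5 ⟨⟨l, Nat.lt_succ_of_le hl⟩, i⟩) h6 h7
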